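/- Let $\mathcal H=l^2(\mathbb Z;\mathbb C^2)$ and $l^1=l^1(\mathbb Z;\mathbb C^2)\subset\mathcal H$, with norms $\|u\|_{l^2}=(\sum_x\|u(x)\|_{\mathbb C^2}^2)^{1/2}$ and $\|u\|_{l^1}=\sum_x\|u(x)\|_{\mathbb C^2}$. Let $S$ be the shift $(Su)(x)=(u_1(x+1),u_2(x-1))$. For a map $C:[0,\infty)^2\to U(2)$ set $(\hat C u)(x)=C(|u_1(x)|^2,|u_2(x)|^2)\,u(x)$, and let $U(t)u_0$, $t\in\mathbb N_0$, be the solution of $u(0)=u_0$, $u(t+1)=S\hat C u(t)$. Assume that $$C(s_1,s_2)=C_0\,C_N(s_1,s_2),\qquad C_0=\begin{pmatrix}a&b\\-\bar b&\bar a\end{pmatrix},\quad a,b\in\mathbb C,\ |a|^2+|b|^2=1,\ 0<|a|<1,$$ and let $U_0=S\hat C_0$ be the linear walk with the constant coin $C_0$. We say that $U(t)u_0$ scatters if there is $u_+\in\mathcal H$ with $\|U(t)u_0-U_0^t u_+\|_{l^2}\to0$ as $t\to\infty$. Theorem. Let $m\in\{2,3\}$, let $C_N\in C^1([0,\infty)^2;U(2))$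 (derivatives at the boundary being one-sided), and suppose that there is $c_0>0$ such that for all $s_1,s_2\ge0$ and $j=1,2$ $$\|C_N(s_1,s_2)-I_2\|\le c_0(s_1+s_2)^m,\qquad \|\partial_{s_j}C_N(s_1,s_2)\|\le c_0(s_1+s_2)^{m-1},$$ where $\|\cdot\|$ is the operator norm on $\mathbb C^2$. 1. If $m=3$, there is $\delta>0$ such that $U(t)u_0$ scatters for every $u_0\in l^2$ with $\|u_0\|_{l^2}<\delta$. 2. If $m=2$, there is $\delta>0$ such that $U(t)u_0$ scatters for every $u_0\in l^1$ with $\|u_0\|_{l^1}<\delta$. -/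

import Mathlib

open Filter Topology

noncomputable section

namespace QW

/-- The internal space `ℂ²`, with its Euclidean norm. -/
abbrev Spinor : Type := EuclideanSpace ℂ (Fin 2)

/-- The state space `ℋ = l²(ℤ; ℂ²)`. -/
abbrev State : Type := lp (fun _ : ℤ => Spinor) 2

/-- The space `l¹(ℤ; ℂ²)`. -/
abbrev StateOne : Type := lp (fun _ : ℤ => Spinor) 1

/-- The unitary group `U(2)`. -/
abbrev U2 : Type := Matrix.unitaryGroup (Fin 2) ℂ

/-- A `2 × 2` matrix as a bounded operator of the Euclidean space `ℂ²`; the norm of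
`op A` is the operator norm of `A`. -/
def op (A : Matrix (Fin 2) (Fin 2) ℂ) : Spinor →L[ℂ] Spinor :=
  Matrix.toEuclideanCLM (n := Fin 2) (𝕜 := ℂ) A

theorem norm_op_unitary (A : U2) (v : Spinor) :
    ‖op (A : Matrix (Fin 2) (Fin 2) ℂ) v‖ = ‖v‖ := by
  have hmem : op (A : Matrix (Fin 2) (Fin 2) ℂ) ∈ unitary (Spinor →L[ℂ] Spinor) :=
    Unitary.map_mem (Matrix.toEuclideanCLM (n := Fin 2) (𝕜 := ℂ)) A.2
  exact ContinuousLinearMap.norm_map_of_mem_unitary hmem v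

theorem memlp_two_iff (u : ℤ → Spinor) :
    Memℓp u 2 ↔ Summable fun x => ‖u x‖ ^ 2 := by
  rw [memℓp_gen_iff (by norm_num)]
  norm_num

/-- The coin operator `(Ĉ u)(x) = C(|u₁(x)|², |u₂(x)|²) u(x)` of `C : ℝ × ℝ → U(2)`. -/
def coin (C : ℝ → ℝ → U2) (u : State) : State :=
  ⟨fun x => op (C (‖u x 0‖ ^ 2) (‖u x 1‖ ^ 2) : Matrix (Fin 2) (Fin 2) ℂ) (u x), by
    refine (memlp_two_iff _).2 ?_
    simp only [norm_op_unitary]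
    exact (memlp_two_iff _).1 (lp.memℓp u)⟩

/-- The shift `S = diag(T₋, T₊)`, where `(T_± f)(x) = f(x ∓ 1)`. -/
def shift (u : State) : State :=
  ⟨fun x => !₂[u (x + 1) 0, u (x - 1) 1], by
    have h := (memlp_two_iff _).1 (lp.memℓp u)
    have h1 : Summable fun x : ℤ => ‖u (x + 1)‖ ^ 2 :=
      h.comp_injective (add_left_injective (1 : ℤ))
    have h2 : Summable fun x : ℤ => ‖u (x - 1)‖ ^ 2 :=
      h.comp_injective (sub_left_injective (b := (1 : ℤ)))
    refine (memlp_two_iff _).2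
      (Summable.of_nonneg_of_le (fun x => by positivity) (fun x => ?_) (h1.add h2))
    simp only [EuclideanSpace.norm_sq_eq, Fin.sum_univ_two]
    simp
    nlinarith [sq_nonneg ‖u (x + 1) 1‖, sq_nonneg ‖u (x - 1) 0‖]⟩

/-- One step `U = S Ĉ` of the quantum walk with coin `C`. -/
def step (C : ℝ → ℝ → U2) (u : State) : State := shift (coin C u)

/-- The evolution `U(t)`: `U(0) u₀ = u₀` and `U(t + 1) u₀ = U (U(t) u₀)`. -/
def evolution (C : ℝ → ℝ → U2) : ℕ → State → State
  | 0, u => u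
  | t + 1, u => step C (evolution C t u)

/-- The linear coin `C₀ = [[a, b], [-b̄, ā]]`. -/
def linearCoin (a b : ℂ) (h : ‖a‖ ^ 2 + ‖b‖ ^ 2 = 1) : U2 :=
  ⟨!![a, b; -(starRingEnd ℂ b), starRingEnd ℂ a], by
    have h' : a * starRingEnd ℂ a + b * starRingEnd ℂ b = 1 := by
      rw [Complex.mul_conj, Complex.mul_conj, Complex.normSq_eq_norm_sq,
        Complex.normSq_eq_norm_sq]
      exact_mod_cast h
    rw [Matrix.mem_unitaryGroup_iff]
    ext i j
    fin_cases i <;> fin_cases j <;>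
      simp [Matrix.mul_apply, Fin.sum_univ_two, Matrix.star_eq_conjTranspose]
    · exact h'
    · ring
    · ring
    · linear_combination h'⟩

/-- The nonlinear coin `C(s₁, s₂) = C₀ C_N(s₁, s₂)`. -/
def nonlinearCoin (C₀ : U2) (CN : ℝ → ℝ → U2) : ℝ → ℝ → U2 :=
  fun s₁ s₂ => C₀ * CN s₁ s₂

/-- The power `U₀ᵗ` of the linear walk `U₀ = S Ĉ₀`, for `t ≥ 0`. -/
def linearEvolution (C₀ : U2) (t : ℕ) (u : State) : State :=
  (step fun _ _ => C₀)^[t] u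

/-- `U(t) u₀`, with the coin `C₀ C_N`, scatters. -/
def Scatters (C₀ : U2) (CN : ℝ → ℝ → U2) (u₀ : State) : Prop :=
  ∃ uPlus : State,
    Tendsto (fun t : ℕ => ‖evolution (nonlinearCoin C₀ CN) t u₀ - linearEvolution C₀ t uPlus‖)
      atTop (𝓝 0)

/-- The coin is only ever evaluated at points of the closed quadrant `[0, ∞)²`. -/
def quadrant : Set (ℝ × ℝ) := Set.Ici 0 ×ˢ Set.Ici 0

/-- `C_N` as a map from pairs to operators. -/
def opFun (CN : ℝ → ℝ → U2) (s : ℝ × ℝ) : Spinor →L[ℂ] Spinor :=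
  op (CN s.1 s.2 : Matrix (Fin 2) (Fin 2) ℂ)

/-- `C_N` is `C¹` on the closed quadrant, and there, for some `c₀ > 0`,
`‖C_N - I₂‖ ≤ c₀ (s₁ + s₂)ᵐ` and `‖∂_{s_j} C_N‖ ≤ c₀ (s₁ + s₂)ᵐ⁻¹` for `j = 1, 2`
(derivatives at the boundary of the quadrant are one-sided). Used for `m ≥ 1` only. -/
structure IsHigherOrder (CN : ℝ → ℝ → U2) (m : ℕ) : Prop where
  contDiffOn : ContDiffOn ℝ 1 (opFun CN) quadrant
  bound : ∃ c₀ : ℝ, 0 < c₀ ∧ ∀ s₁ s₂ : ℝ, 0 ≤ s₁ → 0 ≤ s₂ →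
    ‖op ((CN s₁ s₂ : Matrix (Fin 2) (Fin 2) ℂ) - 1)‖ ≤ c₀ * (s₁ + s₂) ^ m ∧
    ‖derivWithin (fun s => opFun CN (s, s₂)) (Set.Ici 0) s₁‖ ≤ c₀ * (s₁ + s₂) ^ (m - 1) ∧
    ‖derivWithin (fun s => opFun CN (s₁, s)) (Set.Ici 0) s₂‖ ≤ c₀ * (s₁ + s₂) ^ (m - 1)

/-- The inclusion of `l¹(ℤ; ℂ²)` in `l²(ℤ; ℂ²)`. -/
def StateOne.toState (u : StateOne) : State :=
  ⟨fun x => u x, (lp.memℓp u).of_exponent_ge (by norm_num)⟩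

end QW

end

noncomputable section

namespace QW

/-! The linear walk disperses: on point sources `U₀ᵗ` decays in sup norm like `t^(-1/3)`. A small
solution inherits enough of this decay for its nonlinear sources to be summable in time, and then
Duhamel's formula produces `u₊` (`scatters_of_summable`).

Decay. At frequency `ξ` the symbol of `U₀` has determinant `1` and trace `2|a| cos(ξ + arg a)`. By
Cayley–Hamilton its powers are Chebyshev polynomials of the second kind, so the fundamental solution
is built from Fourier coefficients of `sin(tφ)/sin φ` with `φ(ξ) = arccos(|a| cos ξ)`
(`linearWalk_pow_single`). Since `φ''` is a nonvanishing multiple of `cos ξ`, it has only simple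
zeros. Cutting out `t^(-1/3)`-neighbourhoods of these and applying van der Corput to the rest gives
the rate, uniformly in space (`exists_isDispersive`).

Case `m = 3`. `TT*` and a discrete Hardy–Littlewood–Sobolev inequality turn the decay into an `l⁶`
in time, `l^∞` in space bound (`IsDispersive.strichartz`). The source has `l²` norm at most `c₀
‖u‖_∞⁶ ‖u₀‖`, and the sixth power is exactly what Strichartz sums, so the estimate closes for small
data.

Case `m = 2`. Bounding the `l¹` norm of the quintic source by `‖u‖₂² ‖u‖_∞³` with `‖u‖_∞` of size
`t^(-1/3)` gives only `1/t`, which just misses summability. The `l⁸` norm, with rate `t^(-1/4)`, is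
propagated instead. Interpolating the `l¹` and `l²` bounds of the source gives `‖u‖₈^(17/4)`, hence
the integrable rate `s^(-17/16)`; convolution with `t^(-1/4)` then reproduces `t^(-1/4)`. -/

/-! ### Oscillatory integrals -/

/-- **Van der Corput's second derivative test**, with a slowly varying amplitude. -/
theorem abs_integral_mul_sin_le {α β τ A₀ A₁ ε : ℝ} {Φ g h A A' : ℝ → ℝ} (hαβ : α ≤ β)
    (hτ : 0 < τ) (hε : |ε| = 1)
    (hΦ : ∀ x, HasDerivAt Φ (g x) x) (hg : ∀ x, HasDerivAt g (h x) x)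
    (hA : ∀ x, HasDerivAt A (A' x) x) (hhc : Continuous h) (hAc : Continuous A')
    (hA₀ : ∀ x, |A x| ≤ A₀) (hA₁ : ∀ x, |A' x| ≤ A₁)
    (hh : ∀ x ∈ Set.Icc α β, 1 ≤ τ ^ 2 * (ε * h x)) :
    |∫ x in α..β, A x * Real.sin (Φ x)| ≤
      τ * (A₀ * (2 * Real.pi + 1) + A₁ * (β - α)) := by
  have cΦ : Continuous Φ := continuous_iff_continuousAt.2 fun x => (hΦ x).continuousAt
  have cg : Continuous g := continuous_iff_continuousAt.2 fun x => (hg x).continuousAt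
  have cA : Continuous A := continuous_iff_continuousAt.2 fun x => (hA x).continuousAt
  have hpos : ∀ x, 0 < 1 + τ ^ 2 * g x ^ 2 := fun x => by positivity
  have hne : ∀ x, 1 + τ ^ 2 * g x ^ 2 ≠ 0 := fun x => (hpos x).ne'
  have hA₀' : 0 ≤ A₀ := (abs_nonneg _).trans (hA₀ 0)
  have hA₁' : 0 ≤ A₁ := (abs_nonneg _).trans (hA₁ 0)
  have hamgm : ∀ x, τ ^ 2 * |g x| ≤ τ * (1 + τ ^ 2 * g x ^ 2) / 2 := fun x => by
    rw [← sq_abs (g x)]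
    nlinarith [mul_nonneg hτ.le (sq_nonneg (τ * |g x| - 1))]
  -- `B` regularises `A / g`, the factor met when integrating `A sin Φ` by parts. It stays smooth
  -- and `O(τ)` at the zeros of `g`, so no neighbourhood of a stationary point has to be cut out.
  set B : ℝ → ℝ := fun x => τ ^ 2 * A x * g x / (1 + τ ^ 2 * g x ^ 2) with hB
  set B' : ℝ → ℝ := fun x => τ ^ 2 * A' x * g x / (1 + τ ^ 2 * g x ^ 2) +
    τ ^ 2 * A x * h x * (1 - τ ^ 2 * g x ^ 2) / (1 + τ ^ 2 * g x ^ 2) ^ 2 with hB'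
  have hBd : ∀ x, HasDerivAt B (B' x) x := fun x => by
    have h1 := (((hA x).const_mul (τ ^ 2)).mul (hg x)).div
      ((((hg x).pow 2).const_mul (τ ^ 2)).const_add 1) (hne x)
    refine h1.congr_deriv ?_
    have := hne x
    simp only [hB', Pi.pow_apply, Pi.mul_apply]
    field_simp
    ring
  have hBb : ∀ x, |B x| ≤ τ * A₀ / 2 := fun x => by
    rw [hB]
    simp only [abs_div, abs_mul, abs_of_pos (hpos x), abs_of_pos (pow_pos hτ 2)]
    rw [div_le_iff₀ (hpos x)]
    calc τ ^ 2 * |A x| * |g x| = |A x| * (τ ^ 2 * |g x|) := by ring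
      _ ≤ A₀ * (τ * (1 + τ ^ 2 * g x ^ 2) / 2) := by
        gcongr
        · exact hA₀ x
        · exact hamgm x
      _ = _ := by ring
  have cB' : Continuous B' := by
    simp only [hB']
    refine (Continuous.div (by fun_prop) (by fun_prop) hne).add
      (Continuous.div (by fun_prop) (by fun_prop) fun x => pow_ne_zero 2 (hne x))
  set E : ℝ → ℝ := fun x =>
    A x * Real.sin (Φ x) / (1 + τ ^ 2 * g x ^ 2) + B' x * Real.cos (Φ x) with hE
  have cE : Continuous E := by
    simp only [hE]
    exact (Continuous.div (by fun_prop) (by fun_prop) hne).add (by fun_prop)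
  have hBcos : ∀ x, HasDerivAt (fun y => B y * Real.cos (Φ y))
      (E x - A x * Real.sin (Φ x)) x := fun x => by
    refine ((hBd x).mul (hΦ x).cos).congr_deriv ?_
    have := hne x
    simp only [hE, hB]
    field_simp
    ring
  have cS : Continuous fun x => A x * Real.sin (Φ x) := by fun_prop
  have hint := intervalIntegral.integral_eq_sub_of_hasDerivAt (a := α) (b := β)
    (fun x _ => hBcos x) ((cE.sub cS).intervalIntegrable _ _)
  rw [intervalIntegral.integral_sub (cE.intervalIntegrable _ _) (cS.intervalIntegrable _ _)]
    at hint
  -- The lower bound on `ε h` lets the error be dominated by `τ²εh/(1 + τ²g²)`, which is `τ` times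
  -- the derivative of `ε arctan(τg)`. Its integral is at most `τπ` however large `h` becomes.
  set M : ℝ → ℝ := fun x =>
    2 * A₀ * τ * (ε * (1 / (1 + (τ * g x) ^ 2) * (τ * h x))) + τ * A₁ with hM
  have hMd : ∀ x, HasDerivAt
      (fun y => 2 * A₀ * τ * (ε * Real.arctan (τ * g y)) + τ * A₁ * y) (M x) x := fun x => by
    have := (((((hg x).const_mul τ).arctan).const_mul ε).const_mul (2 * A₀ * τ)).add
      ((hasDerivAt_id x).const_mul (τ * A₁))
    exact this.congr_deriv (by simp [hM])
  have cM : Continuous M := by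
    simp only [hM]
    have : Continuous fun x => 1 / (1 + (τ * g x) ^ 2) :=
      Continuous.div (by fun_prop) (by fun_prop) fun x => by positivity
    fun_prop
  have hEM : ∀ x ∈ Set.Ioc α β, ‖E x‖ ≤ M x := fun x hx => by
    have h1 := hh x ⟨hx.1.le, hx.2⟩
    have hp := hpos x
    have e1 : |A x * Real.sin (Φ x) / (1 + τ ^ 2 * g x ^ 2)| ≤
        A₀ * (τ ^ 2 * (ε * h x)) / (1 + τ ^ 2 * g x ^ 2) := by
      rw [abs_div, abs_of_pos hp, abs_mul]
      gcongr
      · exact hA₀ x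
      · exact (Real.abs_sin_le_one _).trans h1
    have e2 : |τ ^ 2 * A' x * g x / (1 + τ ^ 2 * g x ^ 2)| ≤ τ * A₁ := by
      rw [abs_div, abs_of_pos hp, abs_mul, abs_mul, abs_of_pos (pow_pos hτ 2),
        div_le_iff₀ hp]
      calc τ ^ 2 * |A' x| * |g x| = |A' x| * (τ ^ 2 * |g x|) := by ring
        _ ≤ A₁ * (τ * (1 + τ ^ 2 * g x ^ 2) / 2) := by
          gcongr
          · exact hA₁ x
          · exact hamgm x
        _ ≤ _ := by
          have : 0 ≤ A₁ * (τ * (1 + τ ^ 2 * g x ^ 2)) := by positivity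
          linarith
    have hεh : |h x| = ε * h x := by
      have : 0 < ε * h x := by
        by_contra hc
        nlinarith [pow_pos hτ 2]
      rw [← abs_of_pos this, abs_mul, hε, one_mul]
    have e3 : |τ ^ 2 * A x * h x * (1 - τ ^ 2 * g x ^ 2) / (1 + τ ^ 2 * g x ^ 2) ^ 2| ≤
        A₀ * (τ ^ 2 * (ε * h x)) / (1 + τ ^ 2 * g x ^ 2) := by
      rw [abs_div, abs_of_pos (pow_pos hp 2), abs_mul, abs_mul, abs_mul,
        abs_of_pos (pow_pos hτ 2), hεh, div_le_div_iff₀ (pow_pos hp 2) hp]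
      have hq : |1 - τ ^ 2 * g x ^ 2| ≤ 1 + τ ^ 2 * g x ^ 2 := by
        have : 0 ≤ τ ^ 2 * g x ^ 2 := by positivity
        rw [abs_le]; constructor <;> linarith
      have h0 : 0 ≤ ε * h x := hεh ▸ abs_nonneg _
      calc τ ^ 2 * |A x| * (ε * h x) * |1 - τ ^ 2 * g x ^ 2| * (1 + τ ^ 2 * g x ^ 2)
          ≤ τ ^ 2 * A₀ * (ε * h x) * (1 + τ ^ 2 * g x ^ 2) * (1 + τ ^ 2 * g x ^ 2) := by
            gcongr
            exact hA₀ x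
        _ = _ := by ring
    have e4 : |B' x * Real.cos (Φ x)| ≤
        τ * A₁ + A₀ * (τ ^ 2 * (ε * h x)) / (1 + τ ^ 2 * g x ^ 2) := by
      rw [abs_mul]
      calc |B' x| * |Real.cos (Φ x)| ≤ |B' x| * 1 := by
            gcongr; exact Real.abs_cos_le_one _
        _ ≤ _ := by rw [mul_one]; exact (abs_add_le _ _).trans (add_le_add e2 e3)
    rw [Real.norm_eq_abs]
    refine (abs_add_le _ _).trans ((add_le_add e1 e4).trans (le_of_eq ?_))
    simp only [hM, mul_pow]
    field_simp
    ring
  have hEi := intervalIntegral.norm_integral_le_of_norm_le hαβ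
    (MeasureTheory.ae_of_all MeasureTheory.volume hEM) (cM.intervalIntegrable _ _)
  rw [intervalIntegral.integral_eq_sub_of_hasDerivAt (fun x _ => hMd x)
    (cM.intervalIntegrable _ _), Real.norm_eq_abs] at hEi
  have hat : ε * Real.arctan (τ * g β) - ε * Real.arctan (τ * g α) ≤ Real.pi := by
    rw [← mul_sub]
    refine (le_abs_self _).trans ?_
    rw [abs_mul, hε, one_mul, abs_le]
    have := Real.arctan_lt_pi_div_two (τ * g α)
    have := Real.arctan_lt_pi_div_two (τ * g β)
    have := Real.neg_pi_div_two_lt_arctan (τ * g α)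
    have := Real.neg_pi_div_two_lt_arctan (τ * g β)
    constructor <;> linarith
  have hbd : ∀ x, |B x * Real.cos (Φ x)| ≤ τ * A₀ / 2 := fun x => by
    rw [abs_mul]
    calc |B x| * |Real.cos (Φ x)| ≤ |B x| * 1 := by gcongr; exact Real.abs_cos_le_one _
      _ ≤ _ := by rw [mul_one]; exact hBb x
  have hfin : ∫ x in α..β, A x * Real.sin (Φ x) =
      (∫ x in α..β, E x) - B β * Real.cos (Φ β) + B α * Real.cos (Φ α) := by linarith
  rw [hfin]
  have t1 := abs_le.1 hEi
  have t2 := abs_le.1 (hbd α)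
  have t3 := abs_le.1 (hbd β)
  have t4 : 2 * A₀ * τ * (ε * Real.arctan (τ * g β) - ε * Real.arctan (τ * g α)) ≤
      2 * A₀ * τ * Real.pi := by gcongr
  rw [abs_le]
  constructor <;> nlinarith

/-! ### Discrete Hardy–Littlewood–Sobolev inequality -/

theorem sum_Icc_rpow_neg_one_third_le (N : ℕ) :
    ∑ n ∈ Finset.Icc 1 N, (n : ℝ) ^ (-(1 / 3) : ℝ) ≤ 3 / 2 * (N : ℝ) ^ (2 / 3 : ℝ) := by
  induction N with
  | zero => simp
  | succ N ih =>
    rw [Finset.sum_Icc_succ_top (by omega)]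
    have hN : (0 : ℝ) < (N + 1 : ℕ) := by positivity
    have hb := rpow_one_add_le_one_add_mul_self (s := -1 / ((N + 1 : ℕ) : ℝ))
      (by rw [le_div_iff₀ hN]; push_cast; linarith [(Nat.cast_nonneg N : (0 : ℝ) ≤ N)])
      (p := 2 / 3) (by norm_num) (by norm_num)
    have h1 : (1 + -1 / ((N + 1 : ℕ) : ℝ)) = N / ((N + 1 : ℕ) : ℝ) := by
      field_simp; push_cast; ring
    rw [h1, Real.div_rpow (by positivity) hN.le, div_le_iff₀ (by positivity)] at hb
    have h2 : ((N + 1 : ℕ) : ℝ) ^ (2 / 3 : ℝ) =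
        ((N + 1 : ℕ) : ℝ) ^ (-(1 / 3) : ℝ) * ((N + 1 : ℕ) : ℝ) := by
      rw [← Real.rpow_add_one hN.ne']; norm_num
    have h3 : (1 + 2 / 3 * (-1 / ((N + 1 : ℕ) : ℝ))) * ((N + 1 : ℕ) : ℝ) ^ (2 / 3 : ℝ) =
        ((N + 1 : ℕ) : ℝ) ^ (2 / 3 : ℝ) - 2 / 3 * ((N + 1 : ℕ) : ℝ) ^ (-(1 / 3) : ℝ) := by
      rw [h2]; field_simp; ring
    linarith

theorem sum_Ioc_rpow_neg_seven_sixths_le {N M : ℕ} (hN : 1 ≤ N) (hM : N ≤ M) :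
    ∑ n ∈ Finset.Ioc N M, (n : ℝ) ^ (-(7 / 6) : ℝ) ≤
      6 * ((N : ℝ) ^ (-(1 / 6) : ℝ) - (M : ℝ) ^ (-(1 / 6) : ℝ)) := by
  induction M, hM using Nat.le_induction with
  | base => simp
  | succ M hM ih =>
    rw [Finset.sum_Ioc_succ_top (by omega)]
    have hM0 : (0 : ℝ) < M := by exact_mod_cast (by omega : 0 < M)
    have hM1 : (0 : ℝ) < (M + 1 : ℕ) := by positivity
    have hb := rpow_one_add_le_one_add_mul_self (s := -1 / ((M + 1 : ℕ) : ℝ))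
      (by rw [le_div_iff₀ hM1]; push_cast; linarith)
      (p := 1 / 6) (by norm_num) (by norm_num)
    have h1 : (1 + -1 / ((M + 1 : ℕ) : ℝ)) = M / ((M + 1 : ℕ) : ℝ) := by
      field_simp; push_cast; ring
    rw [h1, Real.div_rpow hM0.le hM1.le] at hb
    set x := (M : ℝ) ^ (1 / 6 : ℝ) with hx
    set y := ((M + 1 : ℕ) : ℝ) ^ (1 / 6 : ℝ) with hy
    have hx0 : 0 < x := by positivity
    have hy0 : 0 < y := by positivity
    have e1 : (M : ℝ) ^ (-(1 / 6) : ℝ) = 1 / x := by rw [Real.rpow_neg hM0.le]; simp [hx]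
    have e2 : ((M + 1 : ℕ) : ℝ) ^ (-(1 / 6) : ℝ) = 1 / y := by
      rw [Real.rpow_neg hM1.le]; simp [hy]
    have e3 : ((M + 1 : ℕ) : ℝ) ^ (-(7 / 6) : ℝ) = 1 / y / ((M + 1 : ℕ) : ℝ) := by
      rw [← e2, ← Real.rpow_sub_one hM1.ne']; norm_num
    rw [e2, e3]
    rw [e1] at ih
    set m := ((M + 1 : ℕ) : ℝ)
    have key : 1 / y / m ≤ 6 * (1 / x - 1 / y) := by
      have hle : x / y ≤ 1 - 1 / 6 / m := by
        refine hb.trans (le_of_eq ?_); ring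
      have hxy : x ≤ y := by
        have : x / y ≤ 1 := hle.trans (by have : 0 < 1 / 6 / m := by positivity
                                          linarith)
        rwa [div_le_one hy0] at this
      have h4 : 1 / 6 / m ≤ (y - x) / y := by
        have : (y - x) / y = 1 - x / y := by field_simp
        linarith
      have h5 : (y - x) / y ≤ (y - x) / x := by
        apply div_le_div_of_nonneg_left _ hx0 hxy; linarith
      have h6 : 6 * (1 / x - 1 / y) = 6 * ((y - x) / x) / y := by field_simp
      have h7 : 1 / y / m = 6 * (1 / 6 / m) / y := by field_simp
      rw [h6, h7]
      exact div_le_div_of_nonneg_right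
        (mul_le_mul_of_nonneg_left (h4.trans h5) (by norm_num)) hy0.le
    linarith

/-- The two entries of the minimum cross at `n = β^(-6)`. Below that, `β⁵ ∑ n^(-1/3)` is of order
`β⁵ β^(-4)`; above it, the tail of `∑ n^(-7/6)` is of order `(β^(-6))^(-1/6)`. Both are multiples of
`β`. -/
theorem sum_min_rpow_le {β : ℝ} (hβ : 0 < β) (hβ1 : β ≤ 1) (T : ℕ) :
    ∑ n ∈ Finset.Icc 1 T, min ((n : ℝ) ^ (-(1 / 6) : ℝ)) β ^ 5 * (n : ℝ) ^ (-(1 / 3) : ℝ) ≤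
      14 * β := by
  set N := ⌊β ^ (-6 : ℝ)⌋₊ with hN
  have hR1 : 1 ≤ β ^ (-6 : ℝ) := Real.one_le_rpow_of_pos_of_le_one_of_nonpos hβ hβ1 (by norm_num)
  have hN1 : 1 ≤ N := Nat.le_floor (by simpa using hR1)
  have hNR : (N : ℝ) ≤ β ^ (-6 : ℝ) := Nat.floor_le (by positivity)
  have hRN : β ^ (-6 : ℝ) / 2 ≤ N := by
    have h1 := Nat.lt_floor_add_one (β ^ (-6 : ℝ))
    have h2 : (1 : ℝ) ≤ N := by exact_mod_cast hN1
    rw [← hN] at h1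
    linarith
  have hnear : ∑ n ∈ Finset.Icc 1 N,
      min ((n : ℝ) ^ (-(1 / 6) : ℝ)) β ^ 5 * (n : ℝ) ^ (-(1 / 3) : ℝ) ≤ 3 / 2 * β := by
    calc _ ≤ ∑ n ∈ Finset.Icc 1 N, β ^ 5 * (n : ℝ) ^ (-(1 / 3) : ℝ) := by
          gcongr with n hn
          exact min_le_right _ _
      _ ≤ β ^ 5 * (3 / 2 * (N : ℝ) ^ (2 / 3 : ℝ)) := by
          rw [← Finset.mul_sum]
          gcongr
          exact sum_Icc_rpow_neg_one_third_le N
      _ ≤ β ^ 5 * (3 / 2 * (β ^ (-6 : ℝ)) ^ (2 / 3 : ℝ)) := by gcongr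
      _ = 3 / 2 * β := by
          rw [← Real.rpow_mul hβ.le, mul_left_comm, ← Real.rpow_natCast β 5,
            ← Real.rpow_add hβ]
          norm_num
  have hfar : ∑ n ∈ Finset.Ioc N (max N T),
      min ((n : ℝ) ^ (-(1 / 6) : ℝ)) β ^ 5 * (n : ℝ) ^ (-(1 / 3) : ℝ) ≤ 12 * β := by
    calc _ ≤ ∑ n ∈ Finset.Ioc N (max N T), (n : ℝ) ^ (-(7 / 6) : ℝ) := by
          refine Finset.sum_le_sum fun n hn => ?_
          have hn0 : (0 : ℝ) < n := by
            rw [Finset.mem_Ioc] at hn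
            exact_mod_cast (by omega : 0 < n)
          calc _ ≤ ((n : ℝ) ^ (-(1 / 6) : ℝ)) ^ 5 * (n : ℝ) ^ (-(1 / 3) : ℝ) := by
                gcongr
                exact min_le_left _ _
            _ = _ := by
                rw [← Real.rpow_natCast, ← Real.rpow_mul hn0.le, ← Real.rpow_add hn0]
                norm_num
      _ ≤ 6 * ((N : ℝ) ^ (-(1 / 6) : ℝ) - ((max N T : ℕ) : ℝ) ^ (-(1 / 6) : ℝ)) :=
          sum_Ioc_rpow_neg_seven_sixths_le hN1 (le_max_left _ _)
      _ ≤ 6 * (N : ℝ) ^ (-(1 / 6) : ℝ) := by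
          have : 0 ≤ ((max N T : ℕ) : ℝ) ^ (-(1 / 6) : ℝ) := by positivity
          linarith
      _ ≤ 6 * (β ^ (-6 : ℝ) / 2) ^ (-(1 / 6) : ℝ) := by
          gcongr 6 * ?_
          exact Real.rpow_le_rpow_of_nonpos (by positivity) hRN (by norm_num)
      _ = 6 * (2 ^ (1 / 6 : ℝ) * β) := by
          rw [Real.div_rpow (by positivity) (by norm_num), ← Real.rpow_mul hβ.le,
            Real.rpow_neg (by norm_num : (0 : ℝ) ≤ 2), div_inv_eq_mul]
          norm_num
          ring
      _ ≤ 6 * (2 * β) := by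
          gcongr
          exact (Real.rpow_le_rpow_of_exponent_le (by norm_num) (by norm_num)).trans_eq
            (Real.rpow_one 2)
      _ = 12 * β := by ring
  have hsub : Finset.Icc 1 T ⊆ Finset.Icc 1 N ∪ Finset.Ioc N (max N T) := fun n hn => by
    simp only [Finset.mem_union, Finset.mem_Icc, Finset.mem_Ioc] at hn ⊢
    omega
  have hnn : ∀ n : ℕ, 0 ≤ min ((n : ℝ) ^ (-(1 / 6) : ℝ)) β ^ 5 * (n : ℝ) ^ (-(1 / 3) : ℝ) :=
    fun n => by positivity
  calc _ ≤ _ := Finset.sum_le_sum_of_subset_of_nonneg hsub fun n _ _ => hnn n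
    _ = _ := Finset.sum_union (Finset.disjoint_left.2 fun n h1 h2 => by
        simp only [Finset.mem_Icc, Finset.mem_Ioc] at h1 h2; omega)
    _ ≤ 14 * β := by linarith

theorem sum_range_dist_le {T t : ℕ} (ht : t < T) {w : ℕ → ℝ} (hw : ∀ n, 0 ≤ w n) :
    ∑ s ∈ Finset.range T, w (Nat.dist s t + 1) ≤ 2 * ∑ n ∈ Finset.Icc 1 T, w n := by
  have h1 : ∑ s ∈ Finset.range (t + 1), w (Nat.dist s t + 1) ≤ ∑ n ∈ Finset.Icc 1 T, w n := by
    rw [← Finset.sum_image (s := Finset.range (t + 1)) (g := fun s => Nat.dist s t + 1) (f := w)]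
    · refine Finset.sum_le_sum_of_subset_of_nonneg (fun n hn => ?_) fun n _ _ => hw n
      simp only [Finset.mem_image, Finset.mem_range, Finset.mem_Icc, Nat.dist] at hn ⊢
      omega
    · intro x hx y hy hxy
      simp only [Finset.coe_range, Set.mem_Iio, Nat.dist] at hx hy hxy
      omega
  have h2 : ∑ s ∈ Finset.Ico (t + 1) T, w (Nat.dist s t + 1) ≤
      ∑ n ∈ Finset.Icc 1 T, w n := by
    rw [← Finset.sum_image (s := Finset.Ico (t + 1) T) (g := fun s => Nat.dist s t + 1) (f := w)]
    · refine Finset.sum_le_sum_of_subset_of_nonneg (fun n hn => ?_) fun n _ _ => hw n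
      simp only [Finset.mem_image, Finset.mem_Ico, Finset.mem_Icc, Nat.dist] at hn ⊢
      omega
    · intro x hx y hy hxy
      simp only [Finset.coe_Ico, Set.mem_Ico, Nat.dist] at hx hy hxy
      omega
  rw [← Finset.sum_range_add_sum_Ico _ (by omega : t + 1 ≤ T)]
  linarith

/-- Half of the Hardy–Littlewood–Sobolev sum, where `b s ≤ b t`, for fixed `t`. -/
theorem sum_ite_hls_le {T t : ℕ} (ht : t < T) {b : ℕ → ℝ} (hb : ∀ s, 0 ≤ b s)
    (hS : ∑ s ∈ Finset.range T, b s ^ 6 ≤ 1) :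
    ∑ s ∈ Finset.range T, (if b s ≤ b t then
      b s ^ 5 * ((Nat.dist s t + 1 : ℕ) : ℝ) ^ (-(1 / 3) : ℝ) else 0) ≤ 29 * b t := by
  rcases (hb t).eq_or_lt with h0 | hpos
  · rw [← h0, mul_zero]
    refine Finset.sum_nonpos fun s _ => ?_
    split_ifs with h
    · rw [le_antisymm h (hb s)]; simp
    · rfl
  have hb1 : b t ≤ 1 := by
    have h1 : b t ^ 6 ≤ 1 := (Finset.single_le_sum (f := fun s => b s ^ 6)
      (fun s _ => pow_nonneg (hb s) 6) (Finset.mem_range.2 ht)).trans hS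
    exact (pow_le_one_iff_of_nonneg (hb t) (by norm_num)).1 h1
  -- Write the kernel as `c²` with `c = n^(-1/6)`. If `c ≤ b s`, then `c² ≤ b s * b t` and the term
  -- is absorbed by `∑ b s ^ 6`; otherwise `b s` is at most the minimum of `c` and `b t`.
  have hterm : ∀ s, (if b s ≤ b t then
      b s ^ 5 * ((Nat.dist s t + 1 : ℕ) : ℝ) ^ (-(1 / 3) : ℝ) else 0) ≤
      b t * b s ^ 6 + min (((Nat.dist s t + 1 : ℕ) : ℝ) ^ (-(1 / 6) : ℝ)) (b t) ^ 5 *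
        ((Nat.dist s t + 1 : ℕ) : ℝ) ^ (-(1 / 3) : ℝ) := fun s => by
    have hbs := hb s
    split_ifs with h
    · set n := ((Nat.dist s t + 1 : ℕ) : ℝ)
      have hn : 0 < n := by positivity
      have hc2 : n ^ (-(1 / 3) : ℝ) = (n ^ (-(1 / 6) : ℝ)) ^ 2 := by
        rw [← Real.rpow_natCast, ← Real.rpow_mul hn.le]; norm_num
      rw [hc2]
      set c := n ^ (-(1 / 6) : ℝ)
      have hc : 0 < c := by positivity
      by_cases hcb : c ≤ b s
      · have h1 : b s ^ 5 * c ^ 2 ≤ b t * b s ^ 6 := by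
          calc b s ^ 5 * c ^ 2 = b s ^ 5 * (c * c) := by ring
            _ ≤ b s ^ 5 * (b s * b t) := by
              gcongr
              exact hcb.trans h
            _ = _ := by ring
        have h2 : 0 ≤ min c (b t) ^ 5 * c ^ 2 := by positivity
        linarith
      · have h1 : b s ^ 5 * c ^ 2 ≤ min c (b t) ^ 5 * c ^ 2 := by
          gcongr
          exact le_min (not_le.1 hcb).le h
        have h2 : 0 ≤ b t * b s ^ 6 := by positivity
        linarith
    · positivity
  calc _ ≤ _ := Finset.sum_le_sum fun s _ => hterm s
    _ = b t * ∑ s ∈ Finset.range T, b s ^ 6 + ∑ s ∈ Finset.range T,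
        min (((Nat.dist s t + 1 : ℕ) : ℝ) ^ (-(1 / 6) : ℝ)) (b t) ^ 5 *
        ((Nat.dist s t + 1 : ℕ) : ℝ) ^ (-(1 / 3) : ℝ) := by
      rw [Finset.sum_add_distrib, Finset.mul_sum]
    _ ≤ b t * 1 + 2 * (14 * b t) := by
      gcongr
      refine (sum_range_dist_le ht (w := fun n : ℕ => min ((n : ℝ) ^ (-(1 / 6) : ℝ)) (b t) ^ 5 *
        (n : ℝ) ^ (-(1 / 3) : ℝ)) fun n => by positivity).trans ?_
      gcongr
      exact sum_min_rpow_le hpos hb1 T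
    _ = _ := by ring

/-- The kernel is symmetric, so each pair may be charged to the index with the larger value of `b`.
This costs a factor `2` over `sum_ite_hls_le`. -/
theorem hls_of_sum_le_one {T : ℕ} {b : ℕ → ℝ} (hb : ∀ s, 0 ≤ b s)
    (hS : ∑ s ∈ Finset.range T, b s ^ 6 ≤ 1) :
    ∑ t ∈ Finset.range T, ∑ s ∈ Finset.range T,
      b t ^ 5 * b s ^ 5 * ((Nat.dist s t + 1 : ℕ) : ℝ) ^ (-(1 / 3) : ℝ) ≤ 58 := by
  set P : ℕ → ℕ → ℝ := fun s t => if b s ≤ b t then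
      b s ^ 5 * ((Nat.dist s t + 1 : ℕ) : ℝ) ^ (-(1 / 3) : ℝ) else 0 with hP
  have hhalf : ∑ t ∈ Finset.range T, ∑ s ∈ Finset.range T, b t ^ 5 * P s t ≤ 29 := by
    calc _ ≤ ∑ t ∈ Finset.range T, b t ^ 5 * (29 * b t) := by
          refine Finset.sum_le_sum fun t ht => ?_
          rw [← Finset.mul_sum]
          have := hb t
          gcongr
          exact sum_ite_hls_le (Finset.mem_range.1 ht) hb hS
      _ = 29 * ∑ t ∈ Finset.range T, b t ^ 6 := by
          rw [Finset.mul_sum]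
          exact Finset.sum_congr rfl fun t _ => by ring
      _ ≤ 29 := by linarith
  have hle : ∀ s t, b t ^ 5 * b s ^ 5 * ((Nat.dist s t + 1 : ℕ) : ℝ) ^ (-(1 / 3) : ℝ) ≤
      b t ^ 5 * P s t + b s ^ 5 * P t s := fun s t => by
    have h1 := hb s
    have h2 := hb t
    have hP0 : ∀ s t, 0 ≤ P s t := fun s t => by
      have := hb s
      simp only [hP]; positivity
    rcases le_total (b s) (b t) with h | h
    · have : P s t = b s ^ 5 * ((Nat.dist s t + 1 : ℕ) : ℝ) ^ (-(1 / 3) : ℝ) := if_pos h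
      have := mul_nonneg (pow_nonneg h1 5) (hP0 t s)
      rw [‹P s t = _›, mul_assoc]
      linarith
    · have : P t s = b t ^ 5 * ((Nat.dist t s + 1 : ℕ) : ℝ) ^ (-(1 / 3) : ℝ) := if_pos h
      have := mul_nonneg (pow_nonneg h2 5) (hP0 s t)
      rw [‹P t s = _›, Nat.dist_comm s t]
      nlinarith
  calc _ ≤ ∑ t ∈ Finset.range T, ∑ s ∈ Finset.range T, (b t ^ 5 * P s t + b s ^ 5 * P t s) :=
        Finset.sum_le_sum fun t _ => Finset.sum_le_sum fun s _ => hle s t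
    _ = (∑ t ∈ Finset.range T, ∑ s ∈ Finset.range T, b t ^ 5 * P s t) +
        ∑ s ∈ Finset.range T, ∑ t ∈ Finset.range T, b s ^ 5 * P t s := by
      simp only [Finset.sum_add_distrib]
      congr 1
      exact Finset.sum_comm
    _ ≤ 58 := by linarith

/-- The discrete Hardy–Littlewood–Sobolev inequality for the kernel `(1 + |s - t|)^(-1/3)`,
applied to `b ^ 5`. -/
theorem hardy_littlewood_sobolev {T : ℕ} {b : ℕ → ℝ} {M : ℝ} (hb : ∀ s, 0 ≤ b s) (hM : 0 < M)
    (hS : ∑ s ∈ Finset.range T, b s ^ 6 = M ^ 6) :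
    ∑ t ∈ Finset.range T, ∑ s ∈ Finset.range T,
      b t ^ 5 * b s ^ 5 * ((Nat.dist s t + 1 : ℕ) : ℝ) ^ (-(1 / 3) : ℝ) ≤ 58 * M ^ 10 := by
  have h := hls_of_sum_le_one (T := T) (b := fun s => b s / M)
    (fun s => div_nonneg (hb s) hM.le) (by
      simp only [div_pow, ← Finset.sum_div, hS]
      rw [div_self (by positivity)])
  have he : ∀ s t, (b t / M) ^ 5 * (b s / M) ^ 5 *
      ((Nat.dist s t + 1 : ℕ) : ℝ) ^ (-(1 / 3) : ℝ) =
      b t ^ 5 * b s ^ 5 * ((Nat.dist s t + 1 : ℕ) : ℝ) ^ (-(1 / 3) : ℝ) / M ^ 10 := fun s t => by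
    field_simp
  simp only [he, ← Finset.sum_div] at h
  rwa [div_le_iff₀ (by positivity)] at h

/-! ### Dispersion relation and decay of the scalar kernel -/

/-- The sine of the quasi-energy `arccos (r cos ξ)` of the linear walk. -/
def sinPhase (r ξ : ℝ) : ℝ := √(1 - (r * Real.cos ξ) ^ 2)

theorem one_sub_sq_le (r ξ : ℝ) : 1 - r ^ 2 ≤ 1 - (r * Real.cos ξ) ^ 2 := by
  have := Real.cos_sq_le_one ξ
  rw [mul_pow]
  nlinarith [sq_nonneg r]

theorem sinPhase_pos {r : ℝ} (hr : 0 < 1 - r ^ 2) (ξ : ℝ) : 0 < sinPhase r ξ :=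
  Real.sqrt_pos.2 (hr.trans_le (one_sub_sq_le r ξ))

theorem sinPhase_sq {r : ℝ} (hr : 0 < 1 - r ^ 2) (ξ : ℝ) :
    sinPhase r ξ ^ 2 = 1 - (r * Real.cos ξ) ^ 2 :=
  Real.sq_sqrt (hr.le.trans (one_sub_sq_le r ξ))

theorem sinPhase_le_one (r ξ : ℝ) : sinPhase r ξ ≤ 1 :=
  Real.sqrt_le_one.2 (by nlinarith [sq_nonneg (r * Real.cos ξ)])

theorem le_sinPhase (r ξ : ℝ) : √(1 - r ^ 2) ≤ sinPhase r ξ :=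
  Real.sqrt_le_sqrt (one_sub_sq_le r ξ)

theorem continuous_sinPhase (r : ℝ) : Continuous (sinPhase r) := by
  unfold sinPhase; fun_prop

theorem hasDerivAt_sinPhase {r : ℝ} (hr : 0 < 1 - r ^ 2) (ξ : ℝ) :
    HasDerivAt (sinPhase r) (r ^ 2 * Real.cos ξ * Real.sin ξ / sinPhase r ξ) ξ := by
  have hpos := hr.trans_le (one_sub_sq_le r ξ)
  have h := ((((Real.hasDerivAt_cos ξ).const_mul r).pow 2).const_sub 1).sqrt hpos.ne'
  refine h.congr_deriv ?_
  have hs : √(1 - (r * Real.cos ξ) ^ 2) ≠ 0 := (Real.sqrt_pos.2 hpos).ne'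
  simp only [sinPhase, Pi.pow_apply]
  field_simp
  push_cast
  ring

theorem hasDerivAt_phase {r : ℝ} (hr : 0 < 1 - r ^ 2) (ξ : ℝ) :
    HasDerivAt (fun ξ => Real.arccos (r * Real.cos ξ)) (r * Real.sin ξ / sinPhase r ξ) ξ := by
  have hpos := hr.trans_le (one_sub_sq_le r ξ)
  have h := (Real.hasDerivAt_arccos (x := r * Real.cos ξ) (by rintro h; rw [h] at hpos; norm_num at hpos)
    (by rintro h; rw [h] at hpos; norm_num at hpos)).comp ξ
    ((Real.hasDerivAt_cos ξ).const_mul r)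
  refine h.congr_deriv ?_
  simp only [sinPhase]
  ring

/-- This second derivative of the phase vanishes only with `cos ξ`, hence to first order: the source
of the exponent `1/3`. -/
theorem hasDerivAt_phase_deriv {r : ℝ} (hr : 0 < 1 - r ^ 2) (ξ : ℝ) :
    HasDerivAt (fun ξ => r * Real.sin ξ / sinPhase r ξ)
      ((1 - r ^ 2) * r * Real.cos ξ / sinPhase r ξ ^ 3) ξ := by
  have hs := (sinPhase_pos hr ξ).ne'
  refine (((Real.hasDerivAt_sin ξ).const_mul r).div (hasDerivAt_sinPhase hr ξ) hs).congr_deriv ?_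
  have h2 := sinPhase_sq hr ξ
  have h3 := Real.sin_sq_add_cos_sq ξ
  field_simp
  linear_combination (r * Real.cos ξ) * h2 - r ^ 3 * Real.cos ξ * h3

theorem hasDerivAt_one_div_sinPhase {r : ℝ} (hr : 0 < 1 - r ^ 2) (ξ : ℝ) :
    HasDerivAt (fun ξ => 1 / sinPhase r ξ)
      (-(r ^ 2 * Real.cos ξ * Real.sin ξ) / sinPhase r ξ ^ 3) ξ := by
  have hs := (sinPhase_pos hr ξ).ne'
  simp only [one_div]
  refine ((hasDerivAt_sinPhase hr ξ).inv hs).congr_deriv ?_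
  field_simp

/-- The oscillatory integral of the linear walk over a half period on which `cos` keeps its
sign. -/
theorem abs_integral_half_period_le {r : ℝ} (hr₀ : 0 < r) (hr : 0 < 1 - r ^ 2)
    {t κ α ε : ℝ} (x : ℝ) (hκ : 0 < κ) (hκ1 : κ ≤ 1) (hκt : κ ^ 3 * t = 1) (hε : |ε| = 1)
    (hcos : ∀ ξ ∈ Set.Icc (α + κ) (α + Real.pi - κ), 2 / Real.pi * κ ≤ ε * Real.cos ξ) :
    |∫ ξ in α..α + Real.pi,
        1 / sinPhase r ξ * Real.sin (t * Real.arccos (r * Real.cos ξ) + x * ξ)| ≤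
      κ * (2 * (1 / √(1 - r ^ 2)) + √(Real.pi / (2 * r * (1 - r ^ 2))) *
        (1 / √(1 - r ^ 2) * (2 * Real.pi + 1) + (1 / √(1 - r ^ 2)) ^ 3 * Real.pi)) := by
  have hpi := Real.pi_pos
  have hpi3 := Real.pi_gt_three
  have hs := sinPhase_pos hr
  have hs' : ∀ ξ, sinPhase r ξ ≠ 0 := fun ξ => (hs ξ).ne'
  have cs := continuous_sinPhase r
  have ht : 0 < t := by
    by_contra h
    nlinarith [pow_pos hκ 3]
  set m := √(Real.pi / (2 * r * (1 - r ^ 2))) with hm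
  have hm0 : 0 < m := Real.sqrt_pos.2 (by positivity)
  have hm2 : m ^ 2 = Real.pi / (2 * r * (1 - r ^ 2)) := Real.sq_sqrt (by positivity)
  set A₀ := 1 / √(1 - r ^ 2) with hA₀
  have hA₀0 : 0 < A₀ := by have := Real.sqrt_pos.2 hr; positivity
  have hAle : ∀ ξ, 1 / sinPhase r ξ ≤ A₀ := fun ξ =>
    one_div_le_one_div_of_le (Real.sqrt_pos.2 hr) (le_sinPhase r ξ)
  have hAabs : ∀ ξ, |1 / sinPhase r ξ| ≤ A₀ := fun ξ => by
    rw [abs_of_pos (one_div_pos.2 (hs ξ))]; exact hAle ξ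
  have hA'abs : ∀ ξ, |(-(r ^ 2 * Real.cos ξ * Real.sin ξ) / sinPhase r ξ ^ 3)| ≤ A₀ ^ 3 :=
    fun ξ => by
    have h1 : |r ^ 2 * Real.cos ξ * Real.sin ξ| ≤ 1 := by
      rw [abs_mul, abs_mul]
      have : |r ^ 2| ≤ 1 := by rw [abs_of_nonneg (sq_nonneg r)]; linarith
      exact mul_le_one₀ (mul_le_one₀ this (abs_nonneg _) (Real.abs_cos_le_one _))
        (abs_nonneg _) (Real.abs_sin_le_one _)
    rw [abs_div, abs_neg, abs_of_pos (pow_pos (hs ξ) 3)]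
    calc _ ≤ 1 / sinPhase r ξ ^ 3 := div_le_div_of_nonneg_right h1 (pow_pos (hs ξ) 3).le
      _ = (1 / sinPhase r ξ) ^ 3 := by rw [div_pow, one_pow]
      _ ≤ A₀ ^ 3 := pow_le_pow_left₀ (one_div_pos.2 (hs ξ)).le (hAle ξ) 3
  set f : ℝ → ℝ := fun ξ =>
    1 / sinPhase r ξ * Real.sin (t * Real.arccos (r * Real.cos ξ) + x * ξ) with hf
  have cA : Continuous fun ξ => 1 / sinPhase r ξ := continuous_const.div cs hs'
  have cf : Continuous f := by
    refine cA.mul (Real.continuous_sin.comp ?_)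
    exact (continuous_const.mul (Real.continuous_arccos.comp (by fun_prop))).add (by fun_prop)
  have hfle : ∀ ξ, ‖f ξ‖ ≤ A₀ := fun ξ => by
    rw [Real.norm_eq_abs, hf, abs_mul]
    calc _ ≤ A₀ * 1 := by
          gcongr
          · exact hAabs ξ
          · exact Real.abs_sin_le_one _
      _ = A₀ := mul_one _
  have hmid : |∫ ξ in α + κ..α + Real.pi - κ, f ξ| ≤
      κ * m * (A₀ * (2 * Real.pi + 1) + A₀ ^ 3 * Real.pi) := by
    refine (abs_integral_mul_sin_le (τ := κ * m) (A₀ := A₀) (A₁ := A₀ ^ 3) (ε := ε)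
      (g := fun ξ => t * (r * Real.sin ξ / sinPhase r ξ) + x)
      (h := fun ξ => t * ((1 - r ^ 2) * r * Real.cos ξ / sinPhase r ξ ^ 3))
      (by linarith) (by positivity) hε
      (fun ξ => ?_) (fun ξ => ?_) (hasDerivAt_one_div_sinPhase hr) ?_ ?_ hAabs hA'abs
      fun ξ hξ => ?_).trans ?_
    -- The position `x` enters the phase linearly and disappears from its second derivative; this is
    -- why the bound is uniform in `x`.
    · simpa using ((hasDerivAt_phase hr ξ).const_mul t).fun_add ((hasDerivAt_id ξ).const_mul x)
    · exact ((hasDerivAt_phase_deriv hr ξ).const_mul t).add_const x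
    · exact continuous_const.mul (Continuous.div (by fun_prop) (by fun_prop)
        fun ξ => pow_ne_zero 3 (hs' ξ))
    · exact Continuous.div (by fun_prop) (by fun_prop) fun ξ => pow_ne_zero 3 (hs' ξ)
    · have h1 := hcos ξ hξ
      have h2 : ε * Real.cos ξ ≤ ε * Real.cos ξ / sinPhase r ξ ^ 3 := by
        refine le_div_self (le_trans (by positivity) h1) (pow_pos (hs ξ) 3) ?_
        exact pow_le_one₀ (hs ξ).le (sinPhase_le_one r ξ)
      calc (1 : ℝ) = κ ^ 3 * t := hκt.symm
        _ = (κ * m) ^ 2 * (t * ((1 - r ^ 2) * r * (2 / Real.pi * κ))) := by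
            rw [mul_pow, hm2]
            field_simp
        _ ≤ (κ * m) ^ 2 * (t * ((1 - r ^ 2) * r * (ε * Real.cos ξ / sinPhase r ξ ^ 3))) := by
            gcongr
            exact h1.trans h2
        _ = _ := by ring
    · gcongr
      linarith
  have hleft : |∫ ξ in α..α + κ, f ξ| ≤ A₀ * κ := by
    have := intervalIntegral.norm_integral_le_of_norm_le_const (a := α) (b := α + κ)
      (fun ξ _ => hfle ξ)
    rwa [add_sub_cancel_left, abs_of_pos hκ] at this
  have hright : |∫ ξ in α + Real.pi - κ..α + Real.pi, f ξ| ≤ A₀ * κ := by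
    have := intervalIntegral.norm_integral_le_of_norm_le_const (a := α + Real.pi - κ)
      (b := α + Real.pi) (fun ξ _ => hfle ξ)
    rwa [sub_sub_cancel, abs_of_pos hκ] at this
  have hi : ∀ a b, IntervalIntegrable f MeasureTheory.volume a b :=
    fun a b => cf.intervalIntegrable a b
  rw [← intervalIntegral.integral_add_adjacent_intervals (hi α (α + κ)) (hi _ _),
    ← intervalIntegral.integral_add_adjacent_intervals (hi (α + κ) (α + Real.pi - κ)) (hi _ _)]
  refine (abs_add_le _ _).trans ((add_le_add hleft ((abs_add_le _ _).trans
    (add_le_add hmid hright))).trans (le_of_eq ?_))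
  ring

/-- The period starts at `-π/2` so that it splits into two half periods with the zeros of `cos` at
their endpoints. On the excised intervals, Jordan's inequality bounds `|cos|` below by `2κ/π`. -/
theorem exists_abs_integral_period_le {r : ℝ} (hr₀ : 0 < r) (hr : 0 < 1 - r ^ 2) :
    ∃ K : ℝ, 0 ≤ K ∧ ∀ t κ x : ℝ, 0 < κ → κ ≤ 1 → κ ^ 3 * t = 1 →
      |∫ ξ in -(Real.pi / 2)..3 * Real.pi / 2,
        1 / sinPhase r ξ * Real.sin (t * Real.arccos (r * Real.cos ξ) + x * ξ)| ≤ K * κ := by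
  have hpi := Real.pi_pos
  set K₁ := 2 * (1 / √(1 - r ^ 2)) + √(Real.pi / (2 * r * (1 - r ^ 2))) *
        (1 / √(1 - r ^ 2) * (2 * Real.pi + 1) + (1 / √(1 - r ^ 2)) ^ 3 * Real.pi)
  refine ⟨2 * K₁, by positivity, fun t κ x hκ hκ1 hκt => ?_⟩
  have hsin : ∀ y ∈ Set.Icc κ (Real.pi - κ), 2 / Real.pi * κ ≤ Real.sin y := fun y hy => by
    rcases le_total y (Real.pi / 2) with h | h
    · refine le_trans ?_ (Real.mul_le_sin (hκ.le.trans hy.1) h)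
      gcongr
      exact hy.1
    · rw [← Real.sin_pi_sub]
      refine le_trans ?_ (Real.mul_le_sin (by linarith [hy.2]) (by linarith))
      gcongr
      linarith [hy.2]
  have h1 := abs_integral_half_period_le hr₀ hr (t := t) (α := -(Real.pi / 2)) (ε := 1) x hκ hκ1
    hκt (by simp) fun ξ hξ => by
      rw [one_mul, ← Real.sin_add_pi_div_two]
      exact hsin _ ⟨by linarith [hξ.1], by linarith [hξ.2]⟩
  have h2 := abs_integral_half_period_le hr₀ hr (t := t) (α := Real.pi / 2) (ε := -1) x hκ hκ1
    hκt (by simp) fun ξ hξ => by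
      rw [neg_one_mul, ← Real.sin_sub_pi_div_two]
      exact hsin _ ⟨by linarith [hξ.1], by linarith [hξ.2]⟩
  rw [show -(Real.pi / 2) + Real.pi = Real.pi / 2 by ring] at h1
  rw [show Real.pi / 2 + Real.pi = 3 * Real.pi / 2 by ring] at h2
  have cf : Continuous fun ξ =>
      1 / sinPhase r ξ * Real.sin (t * Real.arccos (r * Real.cos ξ) + x * ξ) := by
    refine (continuous_const.div (continuous_sinPhase r) fun ξ => (sinPhase_pos hr ξ).ne').mul
      (Real.continuous_sin.comp ?_)
    exact (continuous_const.mul (Real.continuous_arccos.comp (by fun_prop))).add (by fun_prop)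
  rw [← intervalIntegral.integral_add_adjacent_intervals (b := Real.pi / 2)
    (cf.intervalIntegrable _ _) (cf.intervalIntegrable _ _)]
  refine (abs_add_le _ _).trans ((add_le_add h1 h2).trans (le_of_eq ?_))
  ring

/-- The real convolution kernel of the linear walk with `|a| = r`: the Fourier coefficients of
the Chebyshev polynomials of the second kind at `r cos ξ`. -/
def walkKernel (r : ℝ) (t : ℕ) (x : ℤ) : ℝ :=
  (2 * Real.pi)⁻¹ * ∫ ξ in -(Real.pi / 2)..3 * Real.pi / 2,
    Real.cos (x * ξ) * Real.sin (t * Real.arccos (r * Real.cos ξ)) / sinPhase r ξ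

theorem continuous_walkKernel_integrand {r : ℝ} (hr : 0 < 1 - r ^ 2) (t : ℕ) (x : ℝ) :
    Continuous fun ξ => Real.cos (x * ξ) * Real.sin (t * Real.arccos (r * Real.cos ξ)) /
      sinPhase r ξ := by
  have h : Continuous fun ξ => Real.arccos (r * Real.cos ξ) :=
    Real.continuous_arccos.comp (by fun_prop)
  exact Continuous.div (by fun_prop) (continuous_sinPhase r) fun ξ => (sinPhase_pos hr ξ).ne'

theorem walkKernel_zero (r : ℝ) (x : ℤ) : walkKernel r 0 x = 0 := by
  simp [walkKernel]

theorem abs_mul_cos_le {r : ℝ} (hr : 0 < 1 - r ^ 2) (ξ : ℝ) : |r * Real.cos ξ| ≤ 1 := by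
  rw [← sq_le_one_iff_abs_le_one]
  linarith [one_sub_sq_le r ξ]

theorem cos_phase {r : ℝ} (hr : 0 < 1 - r ^ 2) (ξ : ℝ) :
    Real.cos (Real.arccos (r * Real.cos ξ)) = r * Real.cos ξ :=
  Real.cos_arccos (abs_le.1 (abs_mul_cos_le hr ξ)).1 (abs_le.1 (abs_mul_cos_le hr ξ)).2

theorem walkKernel_one {r : ℝ} (hr : 0 < 1 - r ^ 2) (x : ℤ) :
    walkKernel r 1 x = if x = 0 then 1 else 0 := by
  have hpi := Real.pi_pos
  have he : ∀ ξ, Real.cos (x * ξ) * Real.sin ((1 : ℕ) * Real.arccos (r * Real.cos ξ)) /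
      sinPhase r ξ = Real.cos (x * ξ) := fun ξ => by
    rw [Nat.cast_one, one_mul, Real.sin_arccos]
    exact mul_div_cancel_right₀ _ (sinPhase_pos hr ξ).ne'
  simp only [walkKernel, he]
  split_ifs with hx
  · simp only [hx, Int.cast_zero, zero_mul, Real.cos_zero, intervalIntegral.integral_const,
      smul_eq_mul, mul_one]
    field_simp
    norm_num
  · have hx' : (x : ℝ) ≠ 0 := by exact_mod_cast hx
    rw [intervalIntegral.integral_comp_mul_left _ hx', integral_cos]
    rw [show (x : ℝ) * (3 * Real.pi / 2) = (x : ℝ) * -(Real.pi / 2) + x * (2 * Real.pi) by ring,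
      Real.sin_add_int_mul_two_pi]
    simp

/-- The Chebyshev recurrence under the integral: multiplication by `2 cos ξ` becomes the sum of the
two neighbouring translates. -/
theorem walkKernel_add_two {r : ℝ} (hr : 0 < 1 - r ^ 2) (t : ℕ) (x : ℤ) :
    walkKernel r (t + 2) x + walkKernel r t x =
      r * (walkKernel r (t + 1) (x + 1) + walkKernel r (t + 1) (x - 1)) := by
  have hi := fun (t : ℕ) (x : ℝ) => (continuous_walkKernel_integrand hr t x).intervalIntegrable
    (μ := MeasureTheory.volume) (-(Real.pi / 2)) (3 * Real.pi / 2)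
  simp only [walkKernel]
  rw [← mul_add, ← mul_add, mul_left_comm r, ← intervalIntegral.integral_add (hi _ _) (hi _ _),
    ← intervalIntegral.integral_add (hi _ _) (hi _ _), ← intervalIntegral.integral_const_mul r]
  congr 2
  ext ξ
  have h1 : Real.sin ((t + 2 : ℕ) * Real.arccos (r * Real.cos ξ)) +
      Real.sin (t * Real.arccos (r * Real.cos ξ)) =
      2 * (r * Real.cos ξ) * Real.sin ((t + 1 : ℕ) * Real.arccos (r * Real.cos ξ)) := by
    set φ := Real.arccos (r * Real.cos ξ) with hφ
    rw [← cos_phase hr ξ, ← hφ, show ((t + 2 : ℕ) : ℝ) * φ = (t + 1 : ℕ) * φ + φ by push_cast; ring,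
      show (t : ℝ) * φ = (t + 1 : ℕ) * φ - φ by push_cast; ring, Real.sin_add, Real.sin_sub]
    ring
  have h2 : Real.cos ((x + 1 : ℤ) * ξ) + Real.cos ((x - 1 : ℤ) * ξ) =
      2 * Real.cos ξ * Real.cos (x * ξ) := by
    rw [show ((x + 1 : ℤ) : ℝ) * ξ = x * ξ + ξ by push_cast; ring,
      show ((x - 1 : ℤ) : ℝ) * ξ = x * ξ - ξ by push_cast; ring, Real.cos_add, Real.cos_sub]
    ring
  rw [← add_div, ← mul_add, h1, ← add_div, ← add_mul, h2]
  ring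

theorem exists_abs_walkKernel_le {r : ℝ} (hr₀ : 0 < r) (hr : 0 < 1 - r ^ 2) :
    ∃ K : ℝ, 0 ≤ K ∧ ∀ (t : ℕ) (x : ℤ),
      |walkKernel r t x| ≤ K * ((t + 1 : ℕ) : ℝ) ^ (-(1 / 3) : ℝ) := by
  obtain ⟨K, hK, h⟩ := exists_abs_integral_period_le hr₀ hr
  refine ⟨2 * K, by positivity, fun t x => ?_⟩
  rcases Nat.eq_zero_or_pos t with rfl | ht
  · rw [walkKernel_zero, abs_zero]; positivity
  have ht' : (0 : ℝ) < t := by exact_mod_cast ht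
  have ht1 : (1 : ℝ) ≤ t := by exact_mod_cast ht
  set κ := (t : ℝ) ^ (-(1 / 3) : ℝ) with hκ
  have hκ0 : 0 < κ := by positivity
  have hκ1 : κ ≤ 1 := Real.rpow_le_one_of_one_le_of_nonpos ht1 (by norm_num)
  have hκt : κ ^ 3 * t = 1 := by
    rw [hκ, ← Real.rpow_natCast, ← Real.rpow_mul ht'.le, ← Real.rpow_add_one ht'.ne']
    norm_num
  -- Shifting `t` to `t + 1` costs a factor at most `2` and keeps the bound meaningful at `t = 0`.
  have hκle : κ ≤ 2 * ((t + 1 : ℕ) : ℝ) ^ (-(1 / 3) : ℝ) := by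
    have h2 : ((t : ℝ) + t) ^ (-(1 / 3) : ℝ) ≤ ((t + 1 : ℕ) : ℝ) ^ (-(1 / 3) : ℝ) := by
      refine Real.rpow_le_rpow_of_nonpos (by positivity) ?_ (by norm_num)
      push_cast; linarith
    rw [← two_mul, Real.mul_rpow (by norm_num) ht'.le] at h2
    have h3 : (1 / 2 : ℝ) ≤ 2 ^ (-(1 / 3) : ℝ) := by
      rw [one_div, ← Real.rpow_neg_one]
      exact Real.rpow_le_rpow_of_exponent_le (by norm_num) (by norm_num)
    nlinarith
  have hp := h t κ x hκ0 hκ1 hκt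
  have hm := h t κ (-x) hκ0 hκ1 hκt
  have hφ : Continuous fun ξ => Real.arccos (r * Real.cos ξ) :=
    Real.continuous_arccos.comp (by fun_prop)
  have hs : Continuous fun ξ => 1 / sinPhase r ξ :=
    continuous_const.div (continuous_sinPhase r) fun ξ => (sinPhase_pos hr ξ).ne'
  have hc : ∀ y : ℝ, Continuous fun ξ =>
      1 / sinPhase r ξ * Real.sin (t * Real.arccos (r * Real.cos ξ) + y * ξ) := fun y => by
    fun_prop
  have hsum : walkKernel r t x = (2 * Real.pi)⁻¹ * (1 / 2 *
      ((∫ ξ in -(Real.pi / 2)..3 * Real.pi / 2,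
        1 / sinPhase r ξ * Real.sin (t * Real.arccos (r * Real.cos ξ) + x * ξ)) +
      ∫ ξ in -(Real.pi / 2)..3 * Real.pi / 2,
        1 / sinPhase r ξ * Real.sin (t * Real.arccos (r * Real.cos ξ) + -x * ξ))) := by
    rw [← intervalIntegral.integral_add ((hc _).intervalIntegrable _ _)
      ((hc _).intervalIntegrable _ _), ← intervalIntegral.integral_const_mul, walkKernel]
    congr 2
    ext ξ
    rw [neg_mul, ← sub_eq_add_neg, Real.sin_add, Real.sin_sub]
    ring
  have hpi : (2 * Real.pi)⁻¹ ≤ 1 := inv_le_one_of_one_le₀ (by linarith [Real.pi_gt_three])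
  have hpi0 : 0 ≤ (2 * Real.pi)⁻¹ := by have := Real.pi_pos; positivity
  rw [hsum, abs_mul, abs_of_nonneg hpi0]
  calc _ ≤ 1 * (1 / 2 * (K * κ + K * κ)) := by
        gcongr
        rw [abs_mul, abs_of_pos (by norm_num : (0 : ℝ) < 1 / 2)]
        gcongr
        exact (abs_add_le _ _).trans (add_le_add hp hm)
    _ = K * κ := by ring
    _ ≤ K * (2 * ((t + 1 : ℕ) : ℝ) ^ (-(1 / 3) : ℝ)) := by gcongr
    _ = _ := by ring

/-! ### Unitarity of the linear walk -/

theorem norm_sq_eq_tsum (u : State) : ‖u‖ ^ 2 = ∑' x, ‖u x‖ ^ 2 := by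
  have h := lp.norm_rpow_eq_tsum (p := 2) (by norm_num) u
  simpa using h

theorem summable_norm_sq (u : State) : Summable fun x => ‖u x‖ ^ 2 :=
  (memlp_two_iff _).1 (lp.memℓp u)

theorem spinor_norm_sq (v : Spinor) : ‖v‖ ^ 2 = ‖v 0‖ ^ 2 + ‖v 1‖ ^ 2 := by
  simp [EuclideanSpace.norm_sq_eq, Fin.sum_univ_two]

@[simp] theorem shift_apply_zero (u : State) (x : ℤ) : shift u x 0 = u (x + 1) 0 := rfl

@[simp] theorem shift_apply_one (u : State) (x : ℤ) : shift u x 1 = u (x - 1) 1 := rfl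

theorem coin_apply (C : ℝ → ℝ → U2) (u : State) (x : ℤ) :
    coin C u x = op (C (‖u x 0‖ ^ 2) (‖u x 1‖ ^ 2) : Matrix (Fin 2) (Fin 2) ℂ) (u x) := rfl

theorem spinor_ext {v w : Spinor} (h₀ : v 0 = w 0) (h₁ : v 1 = w 1) : v = w := by
  ext i; fin_cases i
  · exact h₀
  · exact h₁

theorem norm_shift (u : State) : ‖shift u‖ = ‖u‖ := by
  have h0 : Summable fun x => ‖u x 0‖ ^ 2 := (summable_norm_sq u).of_nonneg_of_le
    (fun x => by positivity) fun x => by rw [spinor_norm_sq]; nlinarith [sq_nonneg ‖u x 1‖]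
  have h1 : Summable fun x => ‖u x 1‖ ^ 2 := (summable_norm_sq u).of_nonneg_of_le
    (fun x => by positivity) fun x => by rw [spinor_norm_sq]; nlinarith [sq_nonneg ‖u x 0‖]
  have h0' := (Equiv.addRight (1 : ℤ)).summable_iff.2 h0
  have h1' := (Equiv.subRight (1 : ℤ)).summable_iff.2 h1
  have e0 := (Equiv.addRight (1 : ℤ)).tsum_eq fun x => ‖u x 0‖ ^ 2
  have e1 := (Equiv.subRight (1 : ℤ)).tsum_eq fun x => ‖u x 1‖ ^ 2
  simp only [Function.comp_def, Equiv.coe_addRight, Equiv.subRight_apply] at h0' h1' e0 e1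
  rw [← sq_eq_sq₀ (norm_nonneg _) (norm_nonneg _), norm_sq_eq_tsum, norm_sq_eq_tsum]
  simp only [spinor_norm_sq, shift_apply_zero, shift_apply_one]
  rw [h0'.tsum_add h1', h0.tsum_add h1, e0, e1]

theorem norm_coin (C : ℝ → ℝ → U2) (u : State) : ‖coin C u‖ = ‖u‖ := by
  rw [← sq_eq_sq₀ (norm_nonneg _) (norm_nonneg _), norm_sq_eq_tsum, norm_sq_eq_tsum]
  simp only [coin_apply, norm_op_unitary]

theorem shift_surjective : Function.Surjective shift := fun v => by
  have h := summable_norm_sq v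
  have h1 : Summable fun x : ℤ => ‖v (x - 1)‖ ^ 2 :=
    h.comp_injective (sub_left_injective (b := (1 : ℤ)))
  have h2 : Summable fun x : ℤ => ‖v (x + 1)‖ ^ 2 :=
    h.comp_injective (add_left_injective (1 : ℤ))
  refine ⟨⟨fun x => !₂[v (x - 1) 0, v (x + 1) 1], (memlp_two_iff _).2
    (Summable.of_nonneg_of_le (fun x => by positivity) (fun x => ?_) (h1.add h2))⟩, ?_⟩
  · simp only [spinor_norm_sq]
    simp
    nlinarith [sq_nonneg ‖v (x - 1) 1‖, sq_nonneg ‖v (x + 1) 0‖]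
  · ext1
    funext x
    refine spinor_ext ?_ ?_
    · rw [shift_apply_zero]
      simp
    · rw [shift_apply_one]
      simp

theorem op_mul_apply (A B : Matrix (Fin 2) (Fin 2) ℂ) (v : Spinor) :
    op (A * B) v = op A (op B v) := by
  simp [op, map_mul]

theorem op_one_apply (v : Spinor) : op 1 v = v := by
  simp [op]

theorem coin_const_surjective (C : U2) : Function.Surjective (coin fun _ _ => C) := fun v => by
  refine ⟨coin (fun _ _ => C⁻¹) v, ?_⟩
  ext1
  funext x
  rw [coin_apply, coin_apply, ← op_mul_apply, ← Submonoid.coe_mul, mul_inv_cancel]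
  exact op_one_apply _

/-- The linear walk `U₀ = S Ĉ₀` as a unitary operator. -/
def linearWalk (C₀ : U2) : State ≃ₗᵢ[ℂ] State :=
  LinearIsometryEquiv.ofSurjective
    { toFun := step fun _ _ => C₀
      map_add' := fun u v => by
        ext1
        funext x
        refine spinor_ext ?_ ?_ <;>
          simp [step, coin_apply, map_add]
      map_smul' := fun c u => by
        ext1
        funext x
        refine spinor_ext ?_ ?_ <;>
          simp [step, coin_apply, lp.coeFn_smul, map_smul]
      norm_map' := fun u => (norm_shift _).trans (norm_coin _ _) }
    (shift_surjective.comp (coin_const_surjective C₀))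

theorem linearWalk_apply (C₀ : U2) (u : State) : linearWalk C₀ u = step (fun _ _ => C₀) u := rfl

theorem isometryEquiv_mul_apply (e e' : State ≃ₗᵢ[ℂ] State) (u : State) :
    (e * e') u = e (e' u) := rfl

theorem linearEvolution_eq (C₀ : U2) (t : ℕ) (u : State) :
    linearEvolution C₀ t u = (linearWalk C₀ ^ t) u := by
  induction t with
  | zero => rfl
  | succ t ih =>
    rw [linearEvolution, Function.iterate_succ_apply', pow_succ', isometryEquiv_mul_apply, ← ih]
    rfl

/-! ### Fundamental solution of the linear walk -/

theorem op_linearCoin_zero (a b : ℂ) (h : ‖a‖ ^ 2 + ‖b‖ ^ 2 = 1) (v : Spinor) :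
    op (linearCoin a b h : Matrix (Fin 2) (Fin 2) ℂ) v 0 = a * v 0 + b * v 1 := by
  simp [op, linearCoin, Matrix.ofLp_toEuclideanCLM, Matrix.mulVec, dotProduct, Fin.sum_univ_two]

theorem op_linearCoin_one (a b : ℂ) (h : ‖a‖ ^ 2 + ‖b‖ ^ 2 = 1) (v : Spinor) :
    op (linearCoin a b h : Matrix (Fin 2) (Fin 2) ℂ) v 1 =
      -(starRingEnd ℂ b) * v 0 + starRingEnd ℂ a * v 1 := by
  simp [op, linearCoin, Matrix.ofLp_toEuclideanCLM, Matrix.mulVec, dotProduct, Fin.sum_univ_two]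

/-- The complex convolution kernel of the linear walk. -/
def phaseKernel (a : ℂ) (t : ℕ) (x : ℤ) : ℂ :=
  (starRingEnd ℂ a / ‖a‖) ^ x * walkKernel ‖a‖ t x

theorem norm_phaseKernel {a : ℂ} (ha : 0 < ‖a‖) (t : ℕ) (x : ℤ) :
    ‖phaseKernel a t x‖ = |walkKernel ‖a‖ t x| := by
  have : ‖starRingEnd ℂ a / ‖a‖‖ = 1 := by
    rw [norm_div, RCLike.norm_conj, Complex.norm_real, norm_norm, div_self ha.ne']
  rw [phaseKernel, norm_mul, norm_zpow, this, one_zpow, one_mul, Complex.norm_real,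
    Real.norm_eq_abs]

theorem phaseKernel_zero (a : ℂ) (x : ℤ) : phaseKernel a 0 x = 0 := by
  simp [phaseKernel, walkKernel_zero]

theorem phaseKernel_one {a : ℂ} (ha : 0 < 1 - ‖a‖ ^ 2) (x : ℤ) :
    phaseKernel a 1 x = if x = 0 then 1 else 0 := by
  rw [phaseKernel, walkKernel_one ha]
  split_ifs with h <;> simp [h]

/-- The gauge factor `(ā/|a|)ˣ` turns the real coefficient `|a|` into `a` and `ā` on the two
neighbours and leaves moduli unchanged. -/
theorem phaseKernel_add_two {a : ℂ} (ha₀ : 0 < ‖a‖) (ha : 0 < 1 - ‖a‖ ^ 2) (t : ℕ) (x : ℤ) :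
    phaseKernel a (t + 2) x + phaseKernel a t x =
      a * phaseKernel a (t + 1) (x + 1) + starRingEnd ℂ a * phaseKernel a (t + 1) (x - 1) := by
  have hn : (‖a‖ : ℂ) ≠ 0 := by exact_mod_cast ha₀.ne'
  have hc : starRingEnd ℂ a ≠ 0 := by
    rw [ne_eq, map_eq_zero]; exact norm_pos_iff.1 ha₀
  have hω : starRingEnd ℂ a / ‖a‖ ≠ 0 := div_ne_zero hc hn
  have haa : a * starRingEnd ℂ a = (‖a‖ : ℂ) ^ 2 := by
    rw [Complex.mul_conj, Complex.normSq_eq_norm_sq]; push_cast; rfl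
  have h := congrArg (fun y : ℝ => (y : ℂ)) (walkKernel_add_two ha t x)
  push_cast at h
  simp only [phaseKernel]
  rw [zpow_add_one₀ hω, zpow_sub_one₀ hω, ← mul_add, h, inv_div]
  field_simp
  linear_combination (-(walkKernel ‖a‖ (t + 1) (x + 1) : ℂ)) * haa

section Dispersive

variable {a b : ℂ} {hab : ‖a‖ ^ 2 + ‖b‖ ^ 2 = 1}

theorem linearWalk_apply_zero (u : State) (x : ℤ) :
    linearWalk (linearCoin a b hab) u x 0 = a * u (x + 1) 0 + b * u (x + 1) 1 :=
  op_linearCoin_zero a b hab (u (x + 1))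

theorem linearWalk_apply_one (u : State) (x : ℤ) :
    linearWalk (linearCoin a b hab) u x 1 =
      -(starRingEnd ℂ b) * u (x - 1) 0 + starRingEnd ℂ a * u (x - 1) 1 :=
  op_linearCoin_one a b hab (u (x - 1))

theorem single_apply_eq_ite (y x : ℤ) (v : Spinor) (i : Fin 2) :
    (lp.single 2 y v : State) x i = if x = y then v i else 0 := by
  rw [lp.single_apply, Pi.single_apply]
  split_ifs <;> rfl

/-- The fundamental solution of the linear walk. -/
theorem linearWalk_pow_single (ha₀ : 0 < ‖a‖) (ha : 0 < 1 - ‖a‖ ^ 2) (y : ℤ) (v : Spinor)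
    (n : ℕ) (x : ℤ) :
    (linearWalk (linearCoin a b hab) ^ (n + 1)) (lp.single 2 y v) x 0 =
      phaseKernel a (n + 1) (x - y + 1) * (a * v 0 + b * v 1) - phaseKernel a n (x - y) * v 0 ∧
    (linearWalk (linearCoin a b hab) ^ (n + 1)) (lp.single 2 y v) x 1 =
      phaseKernel a (n + 1) (x - y - 1) * (-(starRingEnd ℂ b) * v 0 + starRingEnd ℂ a * v 1) -
        phaseKernel a n (x - y) * v 1 := by
  have hu : a * starRingEnd ℂ a + b * starRingEnd ℂ b = 1 := by
    rw [Complex.mul_conj, Complex.mul_conj, Complex.normSq_eq_norm_sq,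
      Complex.normSq_eq_norm_sq]
    exact_mod_cast hab
  induction n generalizing x with
  | zero =>
    rw [zero_add, pow_one, linearWalk_apply_zero, linearWalk_apply_one]
    simp only [single_apply_eq_ite, phaseKernel_one ha, phaseKernel_zero]
    have e1 : x - y + 1 = 0 ↔ x + 1 = y := by omega
    have e2 : x - y - 1 = 0 ↔ x - 1 = y := by omega
    simp only [e1, e2]
    constructor <;> split_ifs <;> simp
  | succ n ih =>
    rw [pow_succ', isometryEquiv_mul_apply, linearWalk_apply_zero, linearWalk_apply_one,
      (ih (x + 1)).1, (ih (x + 1)).2, (ih (x - 1)).1, (ih (x - 1)).2,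
      show x + 1 - y + 1 = x - y + 1 + 1 by ring, show x + 1 - y - 1 = x - y by ring,
      show x + 1 - y = x - y + 1 by ring, show x - 1 - y + 1 = x - y by ring,
      show x - 1 - y - 1 = x - y - 1 - 1 by ring, show x - 1 - y = x - y - 1 by ring]
    have r1 := phaseKernel_add_two ha₀ ha n (x - y + 1)
    have r2 := phaseKernel_add_two ha₀ ha n (x - y - 1)
    rw [add_sub_cancel_right] at r1
    rw [sub_add_cancel] at r2
    -- This is Cayley–Hamilton in position space: `U₀ⁿ⁺¹` is `U₀` convolved with the kernel at `n +
    -- 1`, minus the kernel at `n`. The kernel recurrence supplies the trace, and `hu` the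
    -- determinant.
    constructor
    · linear_combination (-(a * v 0 + b * v 1)) * r1 - phaseKernel a (n + 1) (x - y) * v 0 * hu
    · linear_combination (-(-(starRingEnd ℂ b) * v 0 + starRingEnd ℂ a * v 1)) * r2 -
        phaseKernel a (n + 1) (x - y) * v 1 * hu

theorem spinor_norm_le (v : Spinor) : ‖v‖ ≤ ‖v 0‖ + ‖v 1‖ := by
  refine (sq_le_sq₀ (norm_nonneg _) (by positivity)).1 ?_
  rw [spinor_norm_sq]
  nlinarith [norm_nonneg (v 0), norm_nonneg (v 1)]

theorem norm_coord_le (v : Spinor) (i : Fin 2) : ‖v i‖ ≤ ‖v‖ := PiLp.norm_apply_le v i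

end Dispersive

/-! ### Dispersive and Strichartz estimates -/

/-- The `TT*` argument: a weighted sum of the coefficients of `f` against a family `e` is
controlled by the Gram matrix of `e`. -/
theorem sum_pow_six_le_of_inner {E : Type*} [NormedAddCommGroup E] [InnerProductSpace ℂ E]
    {T : ℕ} {f : E} {e : ℕ → E} {b : ℕ → ℝ} {k : ℕ → ℕ → ℝ} {D : ℝ} (hD : 0 ≤ D)
    (hb : ∀ t, 0 ≤ b t)
    (hf : ∀ t, inner ℂ (e t) f = ((b t ^ 2 : ℝ) : ℂ))
    (he : ∀ s t, ‖inner ℂ (e s) (e t)‖ ≤ D * k s t * b s * b t) {R : ℝ}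
    (hR : ∑ t ∈ Finset.range T, ∑ s ∈ Finset.range T, b t ^ 5 * b s ^ 5 * k s t ≤ R) :
    ∑ t ∈ Finset.range T, b t ^ 6 ≤ √(D * R) * ‖f‖ := by
  -- The weights `b t ^ 4` make the pairing with `f` equal to `∑ b t ^ 6`. As the Gram bound carries
  -- one more `b` per index, `‖w‖²` sees `b ^ 5`, the form `b` takes in the Hardy–Littlewood–Sobolev
  -- sum.
  set w : E := ∑ t ∈ Finset.range T, ((b t ^ 4 : ℝ) : ℂ) • e t with hw
  have hwf : inner ℂ w f = ((∑ t ∈ Finset.range T, b t ^ 6 : ℝ) : ℂ) := by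
    rw [hw, sum_inner, Complex.ofReal_sum]
    refine Finset.sum_congr rfl fun t _ => ?_
    rw [inner_smul_left, hf, Complex.conj_ofReal, ← Complex.ofReal_mul]
    congr 1
    ring
  have hww : ‖w‖ ^ 2 ≤ D * R := by
    have h1 : ‖w‖ ^ 2 = ‖inner ℂ w w‖ := by
      rw [inner_self_eq_norm_sq_to_K]; simp
    have h2 : inner ℂ w w = ∑ t ∈ Finset.range T, ∑ s ∈ Finset.range T,
        ((b t ^ 4 : ℝ) : ℂ) * (((b s ^ 4 : ℝ) : ℂ) * inner ℂ (e s) (e t)) := by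
      conv_lhs => rw [hw, inner_sum]
      refine Finset.sum_congr rfl fun t _ => ?_
      rw [inner_smul_right, sum_inner, Finset.mul_sum]
      refine Finset.sum_congr rfl fun s _ => ?_
      rw [inner_smul_left, Complex.conj_ofReal]
    rw [h1, h2]
    calc _ ≤ ∑ t ∈ Finset.range T, ∑ s ∈ Finset.range T,
          D * (b t ^ 5 * b s ^ 5 * k s t) := by
          refine (norm_sum_le _ _).trans (Finset.sum_le_sum fun t _ => ?_)
          refine (norm_sum_le _ _).trans (Finset.sum_le_sum fun s _ => ?_)
          rw [norm_mul, norm_mul, Complex.norm_real, Complex.norm_real, Real.norm_eq_abs,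
            Real.norm_eq_abs, abs_of_nonneg (pow_nonneg (hb t) 4),
            abs_of_nonneg (pow_nonneg (hb s) 4)]
          have hs := hb s
          have ht := hb t
          calc b t ^ 4 * (b s ^ 4 * ‖inner ℂ (e s) (e t)‖) ≤
                b t ^ 4 * (b s ^ 4 * (D * k s t * b s * b t)) := by
                gcongr
                exact he s t
            _ = _ := by ring
      _ ≤ _ := by
        simp only [← Finset.mul_sum]
        gcongr
  have hS0 : 0 ≤ ∑ t ∈ Finset.range T, b t ^ 6 :=
    Finset.sum_nonneg fun t _ => pow_nonneg (hb t) 6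
  have hle := norm_inner_le_norm (𝕜 := ℂ) w f
  rw [hwf, Complex.norm_real, Real.norm_eq_abs, abs_of_nonneg hS0] at hle
  refine hle.trans ?_
  gcongr
  exact Real.le_sqrt_of_sq_le hww

/-- With `M` the `l⁶` norm of `b`, the two inequalities combine to `M⁶ ≤ √(58 D) M⁵ ‖f‖`, and `M⁵`
cancels. -/
theorem sum_pow_six_le_of_dispersive {E : Type*} [NormedAddCommGroup E] [InnerProductSpace ℂ E]
    {T : ℕ} {f : E} {e : ℕ → E} {b : ℕ → ℝ} {D : ℝ} (hD : 0 ≤ D) (hb : ∀ t, 0 ≤ b t)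
    (hf : ∀ t, inner ℂ (e t) f = ((b t ^ 2 : ℝ) : ℂ))
    (he : ∀ s t, ‖inner ℂ (e s) (e t)‖ ≤
      D * ((Nat.dist s t + 1 : ℕ) : ℝ) ^ (-(1 / 3) : ℝ) * b s * b t) :
    ∑ t ∈ Finset.range T, b t ^ 6 ≤ (√(58 * D) * ‖f‖) ^ 6 := by
  have hS0 : 0 ≤ ∑ t ∈ Finset.range T, b t ^ 6 :=
    Finset.sum_nonneg fun t _ => pow_nonneg (hb t) 6
  rcases hS0.eq_or_lt with h0 | hpos
  · rw [← h0]; positivity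
  obtain ⟨M, hM0, hM6⟩ : ∃ M : ℝ, 0 < M ∧ ∑ t ∈ Finset.range T, b t ^ 6 = M ^ 6 :=
    ⟨(∑ t ∈ Finset.range T, b t ^ 6) ^ (1 / 6 : ℝ), by positivity, by
      rw [← Real.rpow_natCast, ← Real.rpow_mul hS0]; norm_num⟩
  have hle := sum_pow_six_le_of_inner hD hb hf he (hardy_littlewood_sobolev hb hM0 hM6)
  have hsq : √(D * (58 * M ^ 10)) = √(58 * D) * M ^ 5 := by
    rw [show D * (58 * M ^ 10) = 58 * D * (M ^ 5) ^ 2 by ring,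
      Real.sqrt_mul (by positivity), Real.sqrt_sq (by positivity)]
  rw [hM6, hsq] at hle
  rw [hM6]
  have h1 : M * M ^ 5 ≤ √(58 * D) * ‖f‖ * M ^ 5 := by linarith
  have h2 := le_of_mul_le_mul_right h1 (by positivity)
  gcongr

/-- The `l¹`-`l^∞` estimate with decay rate `t^(-1/3)`, for point sources. -/
def IsDispersive (W : State ≃ₗᵢ[ℂ] State) (D : ℝ) : Prop :=
  ∀ (n : ℕ) (y : ℤ) (v : Spinor) (x : ℤ),
    ‖(W ^ n) (lp.single 2 y v) x‖ ≤ D * ((n + 1 : ℕ) : ℝ) ^ (-(1 / 3) : ℝ) * ‖v‖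

theorem exists_isDispersive {a b : ℂ} (hab : ‖a‖ ^ 2 + ‖b‖ ^ 2 = 1) (ha₀ : 0 < ‖a‖)
    (ha₁ : ‖a‖ < 1) : ∃ D : ℝ, 0 < D ∧ IsDispersive (linearWalk (linearCoin a b hab)) D := by
  have ha : 0 < 1 - ‖a‖ ^ 2 := by nlinarith
  obtain ⟨K, hK, hker⟩ := exists_abs_walkKernel_le ha₀ ha
  -- The `1` serves `n = 0`. For later times each of the two components contributes `K` from the
  -- newer kernel and `2 * K` from the older one.
  refine ⟨1 + 6 * K, by positivity, fun n y v x => ?_⟩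
  cases n with
  | zero =>
    have h1 : ‖(lp.single 2 y v : State) x‖ ≤ ‖v‖ := by
      rw [lp.single_apply, Pi.single_apply]
      split_ifs
      · rfl
      · simp
    have h2 : 0 ≤ K * ‖v‖ := by positivity
    simp only [pow_zero, LinearIsometryEquiv.coe_one, id_eq, zero_add, Nat.cast_one,
      Real.one_rpow, mul_one]
    linarith
  | succ n =>
    obtain ⟨h0, h1⟩ := linearWalk_pow_single (hab := hab) ha₀ ha y v n x
    set q := ((n + 1 + 1 : ℕ) : ℝ) ^ (-(1 / 3) : ℝ) with hq
    have hq0 : 0 < q := by positivity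
    have hn : (0 : ℝ) < (n + 1 : ℕ) := by positivity
    have hqn : ((n + 1 : ℕ) : ℝ) ^ (-(1 / 3) : ℝ) ≤ 2 * q := by
      have e1 : (((n + 1 : ℕ) : ℝ) + (n + 1 : ℕ)) ^ (-(1 / 3) : ℝ) ≤ q := by
        refine Real.rpow_le_rpow_of_nonpos (by positivity) ?_ (by norm_num)
        push_cast
        linarith [(Nat.cast_nonneg n : (0 : ℝ) ≤ n)]
      rw [← two_mul, Real.mul_rpow (by norm_num) hn.le] at e1
      have e2 : (1 / 2 : ℝ) ≤ 2 ^ (-(1 / 3) : ℝ) := by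
        rw [one_div, ← Real.rpow_neg_one]
        exact Real.rpow_le_rpow_of_exponent_le (by norm_num) (by norm_num)
      nlinarith [Real.rpow_nonneg hn.le (-(1 / 3) : ℝ)]
    have k1 : ∀ x, ‖phaseKernel a (n + 1) x‖ ≤ K * q := fun x => by
      rw [norm_phaseKernel ha₀]; exact hker _ _
    have k2 : ∀ x, ‖phaseKernel a n x‖ ≤ K * (2 * q) := fun x => by
      rw [norm_phaseKernel ha₀]
      exact (hker _ _).trans (by gcongr)
    have w0 : ‖a * v 0 + b * v 1‖ ≤ ‖v‖ := by
      rw [← op_linearCoin_zero a b hab, ← norm_op_unitary (linearCoin a b hab) v]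
      exact norm_coord_le _ _
    have w1 : ‖-(starRingEnd ℂ b) * v 0 + starRingEnd ℂ a * v 1‖ ≤ ‖v‖ := by
      rw [← op_linearCoin_one a b hab, ← norm_op_unitary (linearCoin a b hab) v]
      exact norm_coord_le _ _
    have c0 : ‖(linearWalk (linearCoin a b hab) ^ (n + 1)) (lp.single 2 y v) x 0‖ ≤
        K * q * ‖v‖ + K * (2 * q) * ‖v‖ := by
      rw [h0]
      refine (norm_sub_le _ _).trans ?_
      rw [norm_mul, norm_mul]
      gcongr
      · exact k1 _
      · exact k2 _
      · exact norm_coord_le v 0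
    have c1 : ‖(linearWalk (linearCoin a b hab) ^ (n + 1)) (lp.single 2 y v) x 1‖ ≤
        K * q * ‖v‖ + K * (2 * q) * ‖v‖ := by
      rw [h1]
      refine (norm_sub_le _ _).trans ?_
      rw [norm_mul, norm_mul]
      gcongr
      · exact k1 _
      · exact k2 _
      · exact norm_coord_le v 1
    have h2 : 0 ≤ q * ‖v‖ := by positivity
    calc _ ≤ _ := spinor_norm_le _
      _ ≤ _ := add_le_add c0 c1
      _ ≤ _ := by nlinarith

namespace IsDispersive

variable {W : State ≃ₗᵢ[ℂ] State} {D : ℝ}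

theorem norm_apply_le (hW : IsDispersive W D) {f : State} (hf : Summable fun x => ‖f x‖)
    (n : ℕ) (x : ℤ) :
    ‖(W ^ n) f x‖ ≤ D * ((n + 1 : ℕ) : ℝ) ^ (-(1 / 3) : ℝ) * ∑' y, ‖f y‖ := by
  have h1 := lp.hasSum_single (p := 2) (by norm_num) f
  have h2 := ((lp.evalCLM ℂ (fun _ : ℤ => Spinor) 2 x).comp
    ((W ^ n).toContinuousLinearEquiv : State →L[ℂ] State)).hasSum h1
  have h3 := tsum_of_norm_bounded (hf.hasSum.mul_left (D * ((n + 1 : ℕ) : ℝ) ^ (-(1 / 3) : ℝ)))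
    fun y => hW n y (f y) x
  have h4 := h2.tsum_eq
  exact (congrArg norm h4).symm.le.trans h3

/-- By unitarity the inner product is the evolution of one point source over time `t - s`, tested at
one site; these are the Gram entries needed for `TT*`. -/
theorem norm_inner_single_le (hW : IsDispersive W D) {s t : ℕ} (hst : s ≤ t) (x y : ℤ)
    (v w : Spinor) :
    ‖inner ℂ ((W ^ s)⁻¹ (lp.single 2 x v)) ((W ^ t)⁻¹ (lp.single 2 y w))‖ ≤
      D * ((Nat.dist s t + 1 : ℕ) : ℝ) ^ (-(1 / 3) : ℝ) * ‖v‖ * ‖w‖ := by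
  have h1 : (W ^ t) ((W ^ s)⁻¹ (lp.single 2 x v)) = (W ^ (t - s)) (lp.single 2 x v) := by
    rw [← isometryEquiv_mul_apply, pow_sub W hst]
  have h2 : (W ^ t) ((W ^ t)⁻¹ (lp.single 2 y w)) = lp.single 2 y w := by
    rw [← isometryEquiv_mul_apply, mul_inv_cancel]; rfl
  rw [← (W ^ t).inner_map_map, h1, h2, norm_inner_symm, lp.inner_single_left,
    Nat.dist_eq_sub_of_le hst]
  calc _ ≤ _ := norm_inner_le_norm _ _
    _ ≤ ‖w‖ * (D * ((t - s + 1 : ℕ) : ℝ) ^ (-(1 / 3) : ℝ) * ‖v‖) := by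
      gcongr
      exact hW _ _ _ _
    _ = _ := by ring

theorem norm_inner_single_le' (hW : IsDispersive W D) (s t : ℕ) (x y : ℤ) (v w : Spinor) :
    ‖inner ℂ ((W ^ s)⁻¹ (lp.single 2 x v)) ((W ^ t)⁻¹ (lp.single 2 y w))‖ ≤
      D * ((Nat.dist s t + 1 : ℕ) : ℝ) ^ (-(1 / 3) : ℝ) * ‖v‖ * ‖w‖ := by
  rcases le_total s t with h | h
  · exact hW.norm_inner_single_le h x y v w
  · rw [norm_inner_symm, Nat.dist_comm, mul_right_comm]
    exact hW.norm_inner_single_le h y x w v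

/-- The `l⁶` in time, `l^∞` in space **Strichartz estimate**, with the supremum in space
replaced by the values along an arbitrary trajectory. -/
theorem strichartz (hW : IsDispersive W D) (hD : 0 ≤ D) (f : State) (X : ℕ → ℤ) (T : ℕ) :
    ∑ t ∈ Finset.range T, ‖(W ^ t) f (X t)‖ ^ 6 ≤ (√(58 * D) * ‖f‖) ^ 6 := by
  have hb0 : ∀ t, 0 ≤ ‖(W ^ t) f (X t)‖ := fun t => norm_nonneg _
  have hinner : ∀ t, inner ℂ ((W ^ t)⁻¹ (lp.single 2 (X t) ((W ^ t) f (X t)))) f =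
      ((‖(W ^ t) f (X t)‖ ^ 2 : ℝ) : ℂ) := fun t => by
    have h2 : (W ^ t) ((W ^ t)⁻¹ (lp.single 2 (X t) ((W ^ t) f (X t)))) =
        lp.single 2 (X t) ((W ^ t) f (X t)) := by
      rw [← isometryEquiv_mul_apply, mul_inv_cancel]; rfl
    rw [← (W ^ t).inner_map_map, h2, lp.inner_single_left]
    exact (inner_self_eq_norm_sq_to_K (𝕜 := ℂ) ((W ^ t) f (X t))).trans (by simp)
  exact sum_pow_six_le_of_dispersive hD hb0 hinner
    fun s t => hW.norm_inner_single_le' s t (X s) (X t) _ _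

end IsDispersive

/-! ### Nonlinear evolution and Duhamel's formula -/

/-- The deviation `(Ĉ_N - 1) u` of the nonlinear coin from the identity. -/
def nonlinearity (CN : ℝ → ℝ → U2) (u : State) : State := coin CN u - u

theorem norm_nonlinearity_apply_le {CN : ℝ → ℝ → U2} {c₀ : ℝ} {m : ℕ}
    (h : ∀ s₁ s₂ : ℝ, 0 ≤ s₁ → 0 ≤ s₂ →
      ‖op ((CN s₁ s₂ : Matrix (Fin 2) (Fin 2) ℂ) - 1)‖ ≤ c₀ * (s₁ + s₂) ^ m)
    (u : State) (x : ℤ) : ‖nonlinearity CN u x‖ ≤ c₀ * ‖u x‖ ^ (2 * m) * ‖u x‖ := by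
  have he : nonlinearity CN u x =
      op ((CN (‖u x 0‖ ^ 2) (‖u x 1‖ ^ 2) : Matrix (Fin 2) (Fin 2) ℂ) - 1) (u x) := by
    have h1 : op ((CN (‖u x 0‖ ^ 2) (‖u x 1‖ ^ 2) : Matrix (Fin 2) (Fin 2) ℂ) - 1) (u x) =
        op (CN (‖u x 0‖ ^ 2) (‖u x 1‖ ^ 2) : Matrix (Fin 2) (Fin 2) ℂ) (u x) - op 1 (u x) := by
      simp [op, map_sub]
    rw [h1, op_one_apply]
    rfl
  rw [he]
  refine (ContinuousLinearMap.le_opNorm _ _).trans ?_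
  gcongr
  rw [pow_mul, spinor_norm_sq]
  exact h _ _ (by positivity) (by positivity)

theorem step_nonlinearCoin (C₀ : U2) (CN : ℝ → ℝ → U2) (u : State) :
    step (nonlinearCoin C₀ CN) u = linearWalk C₀ (u + nonlinearity CN u) := by
  rw [nonlinearity, add_sub_cancel, linearWalk_apply, step, step]
  congr 1
  ext1
  funext x
  rw [coin_apply, coin_apply, coin_apply, nonlinearCoin, Submonoid.coe_mul, op_mul_apply]

theorem norm_evolution (C : ℝ → ℝ → U2) (t : ℕ) (u : State) : ‖evolution C t u‖ = ‖u‖ := by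
  induction t with
  | zero => rfl
  | succ t ih => rw [evolution, step, norm_shift, norm_coin, ih]

theorem pow_inv_apply (W : State ≃ₗᵢ[ℂ] State) {s t : ℕ} (h : s ≤ t) (u : State) :
    (W ^ t) ((W ^ s)⁻¹ u) = (W ^ (t - s)) u := by
  rw [← isometryEquiv_mul_apply, pow_sub W h]

/-- Duhamel's formula. -/
theorem evolution_eq (C₀ : U2) (CN : ℝ → ℝ → U2) (u₀ : State) (t : ℕ) :
    evolution (nonlinearCoin C₀ CN) t u₀ = (linearWalk C₀ ^ t) (u₀ + ∑ s ∈ Finset.range t,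
      (linearWalk C₀ ^ s)⁻¹ (nonlinearity CN (evolution (nonlinearCoin C₀ CN) s u₀))) := by
  induction t with
  | zero => simp [evolution]
  | succ t ih =>
    rw [evolution, step_nonlinearCoin, Finset.sum_range_succ, ← add_assoc, map_add, map_add,
      pow_inv_apply _ (Nat.le_succ t), Nat.succ_sub (le_refl t), Nat.sub_self, pow_one, pow_succ',
      isometryEquiv_mul_apply, ← ih]

/-- Pulled back by the unitary `U₀ᵗ`, the solution is `u₀` plus a partial sum of an absolutely
convergent series in `l²`; `u₊` is the limit. -/
theorem scatters_of_summable {C₀ : U2} {CN : ℝ → ℝ → U2} {u₀ : State}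
    (h : Summable fun s => ‖nonlinearity CN (evolution (nonlinearCoin C₀ CN) s u₀)‖) :
    Scatters C₀ CN u₀ := by
  set g : ℕ → State := fun s =>
    (linearWalk C₀ ^ s)⁻¹ (nonlinearity CN (evolution (nonlinearCoin C₀ CN) s u₀)) with hg
  have hs : Summable g := by
    refine Summable.of_norm ?_
    simpa only [hg, LinearIsometryEquiv.norm_map] using h
  refine ⟨u₀ + ∑' s, g s, ?_⟩
  have h1 := (hs.hasSum.tendsto_sum_nat.const_add u₀).sub_const (u₀ + ∑' s, g s)
  rw [sub_self] at h1
  refine h1.norm.congr' (.of_forall fun t => ?_) |>.trans (by rw [norm_zero])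
  rw [evolution_eq, linearEvolution_eq, ← map_sub, LinearIsometryEquiv.norm_map]

/-! ### The case `m = 3` -/

theorem norm_le_mul_norm_of_apply_le {g u : State} {k : ℝ} (hk : 0 ≤ k)
    (h : ∀ x, ‖g x‖ ≤ k * ‖u x‖) : ‖g‖ ≤ k * ‖u‖ := by
  refine (sq_le_sq₀ (norm_nonneg _) (by positivity)).1 ?_
  rw [mul_pow, norm_sq_eq_tsum, norm_sq_eq_tsum, ← tsum_mul_left]
  refine (summable_norm_sq g).tsum_le_tsum (fun x => ?_) ((summable_norm_sq u).mul_left _)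
  rw [← mul_pow]
  exact pow_le_pow_left₀ (norm_nonneg _) (h x) 2

/-- Square summable sequences tend to zero, so their supremum is attained. Strichartz along a
trajectory of maximisers then controls the `l^∞` norm. -/
theorem exists_forall_norm_apply_le (u : State) : ∃ x₀, ∀ x, ‖u x‖ ≤ ‖u x₀‖ := by
  by_cases hu : ∃ z, 0 < ‖u z‖
  · obtain ⟨z, hz⟩ := hu
    have h1 := (summable_norm_sq u).tendsto_cofinite_zero
    have h2 := h1.eventually (gt_mem_nhds (pow_pos hz 2))
    rw [← cocompact_eq_cofinite] at h2
    exact continuous_of_discreteTopology.exists_forall_ge' (f := fun x => ‖u x‖) z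
      (h2.mono fun x hx => (lt_of_pow_lt_pow_left₀ 2 (norm_nonneg _) hx).le)
  · push Not at hu
    exact ⟨0, fun x => (hu x).trans (norm_nonneg _)⟩

instance fact_one_le_six : Fact ((1 : ENNReal) ≤ 6) := ⟨by norm_num⟩

instance fact_one_le_eight : Fact ((1 : ENNReal) ≤ 8) := ⟨by norm_num⟩

/-- Minkowski's inequality for sums of sequences in the `l⁶` norm. -/
theorem sum_norm_pow_six_le {T S : ℕ} {F H : ℕ → Spinor} {g : ℕ → ℕ → Spinor} {α : ℝ}
    {β : ℕ → ℝ} (hF : ∀ t < T, F t = H t + ∑ s ∈ Finset.range S, g s t) (hα : 0 ≤ α)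
    (hβ : ∀ s, 0 ≤ β s) (hH : ∑ t ∈ Finset.range T, ‖H t‖ ^ 6 ≤ α ^ 6)
    (hg : ∀ s < S, ∑ t ∈ Finset.range T, ‖g s t‖ ^ 6 ≤ β s ^ 6) :
    ∑ t ∈ Finset.range T, ‖F t‖ ^ 6 ≤ (α + ∑ s ∈ Finset.range S, β s) ^ 6 := by
  set V : (ℕ → Spinor) → PiLp 6 (fun _ : Fin T => Spinor) := fun F =>
    WithLp.toLp 6 fun t => F t with hV
  have hnorm : ∀ F, ‖V F‖ ^ 6 = ∑ t ∈ Finset.range T, ‖F t‖ ^ 6 := fun F => by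
    rw [PiLp.norm_eq_of_nat 6 (by norm_num), ← Real.rpow_natCast, ← Real.rpow_mul
      (Finset.sum_nonneg fun _ _ => by positivity), Finset.sum_range]
    norm_num
    rfl
  have hdec : V F = V H + ∑ s ∈ Finset.range S, V (g s) := by
    ext t i
    simp [hV, hF t t.2]
  rw [← hnorm, hdec]
  have h1 : ‖V H‖ ≤ α := (pow_le_pow_iff_left₀ (norm_nonneg _) hα (by norm_num : 6 ≠ 0)).1
    ((hnorm H).trans_le hH)
  have h2 : ∀ s ∈ Finset.range S, ‖V (g s)‖ ≤ β s := fun s hs =>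
    (pow_le_pow_iff_left₀ (norm_nonneg _) (hβ s) (by norm_num : 6 ≠ 0)).1
    ((hnorm _).trans_le (hg s (Finset.mem_range.1 hs)))
  gcongr
  exact (norm_add_le _ _).trans (add_le_add h1 ((norm_sum_le _ _).trans (Finset.sum_le_sum h2)))

theorem exists_scatters_of_septic {C₀ : U2} {CN : ℝ → ℝ → U2} {D c₀ : ℝ} (hD : 0 < D)
    (hW : IsDispersive (linearWalk C₀) D) (hc₀ : 0 < c₀)
    (hCN : ∀ s₁ s₂ : ℝ, 0 ≤ s₁ → 0 ≤ s₂ →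
      ‖op ((CN s₁ s₂ : Matrix (Fin 2) (Fin 2) ℂ) - 1)‖ ≤ c₀ * (s₁ + s₂) ^ 3) :
    ∃ δ : ℝ, 0 < δ ∧ ∀ u₀ : State, ‖u₀‖ < δ → Scatters C₀ CN u₀ := by
  set K := √(58 * D) with hK
  have hK0 : 0 < K := by positivity
  have hlim : Tendsto (fun d : ℝ => c₀ * (2 * (K * d)) ^ 6) (𝓝 0) (𝓝 0) := by
    have : Continuous fun d : ℝ => c₀ * (2 * (K * d)) ^ 6 := by fun_prop
    simpa using this.tendsto 0
  obtain ⟨δ, hδ, hsmall⟩ := Metric.eventually_nhds_iff.1 (hlim.eventually (gt_mem_nhds one_pos))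
  refine ⟨δ, hδ, fun u₀ hu₀ => ?_⟩
  have hd := hsmall (y := ‖u₀‖) (by simpa using hu₀)
  set u : ℕ → State := fun t => evolution (nonlinearCoin C₀ CN) t u₀ with hu
  choose X hX using fun t => exists_forall_norm_apply_le (u t)
  have hG : ∀ s, ‖nonlinearity CN (u s)‖ ≤ c₀ * ‖u s (X s)‖ ^ 6 * ‖u₀‖ := fun s => by
    rw [← norm_evolution (nonlinearCoin C₀ CN) s u₀]
    refine norm_le_mul_norm_of_apply_le (by positivity) fun x => ?_
    refine (norm_nonlinearity_apply_le hCN _ x).trans ?_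
    gcongr
    exact hX s x
  -- Time is discrete and sources act strictly later, so induction on `T` replaces a continuity
  -- argument: the bound over times below `T` controls every source felt up to time `T`.
  have hbound : ∀ T, ∑ t ∈ Finset.range T, ‖u t (X t)‖ ^ 6 ≤ (2 * (K * ‖u₀‖)) ^ 6 := fun T => by
    induction T with
    | zero => rw [Finset.range_zero, Finset.sum_empty]; positivity
    | succ T ih =>
      have hmink := sum_norm_pow_six_le (T := T + 1) (S := T) (F := fun t => u t (X t))
        (H := fun t => (linearWalk C₀ ^ t) u₀ (X t))
        -- The cutoff `s < t` makes the range of the Duhamel sum independent of `t`. For each fixed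
        -- `s` it only discards nonnegative terms, so the homogeneous Strichartz estimate suffices.
        (g := fun s t => if s < t then
          (linearWalk C₀ ^ t) ((linearWalk C₀ ^ s)⁻¹ (nonlinearity CN (u s))) (X t) else 0)
        (α := K * ‖u₀‖) (β := fun s => K * ‖nonlinearity CN (u s)‖)
        (fun t ht => by
          simp only [hu]
          rw [evolution_eq, map_add, map_sum, lp.coeFn_add, Pi.add_apply, lp.coeFn_sum,
            Finset.sum_apply, ← Finset.sum_filter]
          congr 2
          ext s
          simp only [Finset.mem_filter, Finset.mem_range]
          omega)
        (by positivity) (fun s => by positivity) (hW.strichartz hD.le u₀ X _)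
        (fun s _ => by
          have h1 := hW.strichartz hD.le
            ((linearWalk C₀ ^ s)⁻¹ (nonlinearity CN (u s))) X (T + 1)
          rw [LinearIsometryEquiv.norm_map] at h1
          refine le_trans (Finset.sum_le_sum fun t _ => ?_) h1
          split_ifs
          · rfl
          · rw [norm_zero, zero_pow (by norm_num)]; positivity)
      refine hmink.trans ?_
      gcongr
      calc K * ‖u₀‖ + ∑ s ∈ Finset.range T, K * ‖nonlinearity CN (u s)‖
          ≤ K * ‖u₀‖ + ∑ s ∈ Finset.range T, K * (c₀ * ‖u s (X s)‖ ^ 6 * ‖u₀‖) := by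
            gcongr with s
            exact hG s
        _ = K * ‖u₀‖ * (1 + c₀ * ∑ s ∈ Finset.range T, ‖u s (X s)‖ ^ 6) := by
            rw [mul_add, mul_one, Finset.mul_sum, Finset.mul_sum]
            congr 1
            exact Finset.sum_congr rfl fun s _ => by ring
        _ ≤ K * ‖u₀‖ * (1 + 1) := by
            gcongr
            exact (mul_le_mul_of_nonneg_left ih hc₀.le).trans hd.le
        _ = _ := by ring
  have hsum : Summable fun t => ‖u t (X t)‖ ^ 6 :=
    summable_of_sum_range_le (fun t => by positivity) hbound
  exact scatters_of_summable (((hsum.mul_left c₀).mul_right ‖u₀‖).of_nonneg_of_le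
    (fun s => norm_nonneg _) hG)

/-! ### The case `m = 2` -/

/-- The `l⁸` norm of a state. -/
def eightNorm (u : State) : ℝ :=
  ‖lp.linearMapOfLE ℂ (fun _ : ℤ => Spinor) (p := 2) (q := 8) (by norm_num) u‖

theorem eightNorm_nonneg (u : State) : 0 ≤ eightNorm u := norm_nonneg _

theorem eightNorm_add_le (u v : State) : eightNorm (u + v) ≤ eightNorm u + eightNorm v := by
  rw [eightNorm, map_add]
  exact norm_add_le _ _

theorem eightNorm_sum_le {ι : Type*} (s : Finset ι) (f : ι → State) :
    eightNorm (∑ i ∈ s, f i) ≤ ∑ i ∈ s, eightNorm (f i) := by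
  rw [eightNorm, map_sum]
  exact norm_sum_le _ _

theorem norm_apply_le_eightNorm (u : State) (x : ℤ) : ‖u x‖ ≤ eightNorm u :=
  lp.norm_apply_le_norm (by norm_num)
    (lp.linearMapOfLE ℂ (fun _ : ℤ => Spinor) (p := 2) (q := 8) (by norm_num) u) x

theorem hasSum_eightNorm (u : State) : HasSum (fun x => ‖u x‖ ^ 8) (eightNorm u ^ 8) := by
  have h := lp.hasSum_norm (p := 8) (by norm_num)
    (lp.linearMapOfLE ℂ (fun _ : ℤ => Spinor) (p := 2) (q := 8) (by norm_num) u)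
  simpa [eightNorm] using h

theorem hasSum_norm_sq (u : State) : HasSum (fun x => ‖u x‖ ^ 2) (‖u‖ ^ 2) := by
  rw [norm_sq_eq_tsum]
  exact (summable_norm_sq u).hasSum

/-- The linear walk maps `l¹ ∩ l²` to `l⁸`, with decay rate `t^(-1/4)`. -/
theorem IsDispersive.eightNorm_le {W : State ≃ₗᵢ[ℂ] State} {D : ℝ} (hD : 0 < D)
    (hW : IsDispersive W D) {f : State} {A B R : ℝ} (hf : HasSum (fun x => ‖f x‖) A)
    (hB : ‖f‖ ≤ B) (hR : 0 ≤ R) (hAB : A ^ 6 * B ^ 2 ≤ R ^ 8) (n : ℕ) :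
    eightNorm ((W ^ n) f) ≤ D ^ (3 / 4 : ℝ) * ((n + 1 : ℕ) : ℝ) ^ (-(1 / 4) : ℝ) * R := by
  have hn : (0 : ℝ) < (n + 1 : ℕ) := by positivity
  have hA : 0 ≤ A := hf.nonneg fun x => norm_nonneg _
  refine (pow_le_pow_iff_left₀ (eightNorm_nonneg _) (by positivity) (by norm_num : 8 ≠ 0)).1 ?_
  have h1 : (D ^ (3 / 4 : ℝ)) ^ 8 = D ^ 6 := by
    rw [← Real.rpow_natCast, ← Real.rpow_mul hD.le, ← Real.rpow_natCast]; norm_num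
  have h2 : (((n + 1 : ℕ) : ℝ) ^ (-(1 / 4) : ℝ)) ^ 8 =
      (((n + 1 : ℕ) : ℝ) ^ (-(1 / 3) : ℝ)) ^ 6 := by
    rw [← Real.rpow_natCast, ← Real.rpow_natCast, ← Real.rpow_mul hn.le, ← Real.rpow_mul hn.le]
    norm_num
  rw [mul_pow, mul_pow, h1, h2]
  set q := ((n + 1 : ℕ) : ℝ) ^ (-(1 / 3) : ℝ)
  -- Interpolation: six of the eight powers decay through the `l¹`–`l^∞` bound, and the other two
  -- are kept by unitarity on `l²`.
  have hx : ∀ x, ‖(W ^ n) f x‖ ^ 8 ≤ (D * q * A) ^ 6 * ‖(W ^ n) f x‖ ^ 2 := fun x => by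
    have h3 := hW.norm_apply_le hf.summable n x
    rw [hf.tsum_eq] at h3
    calc ‖(W ^ n) f x‖ ^ 8 = ‖(W ^ n) f x‖ ^ 6 * ‖(W ^ n) f x‖ ^ 2 := by ring
      _ ≤ _ := by gcongr
  have h4 := hasSum_le hx (hasSum_eightNorm _) ((hasSum_norm_sq ((W ^ n) f)).mul_left _)
  rw [LinearIsometryEquiv.norm_map] at h4
  calc _ ≤ _ := h4
    _ ≤ (D * q * A) ^ 6 * B ^ 2 := by gcongr
    _ = D ^ 6 * q ^ 6 * (A ^ 6 * B ^ 2) := by ring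
    _ ≤ _ := by gcongr

theorem sum_norm_pow_five_le (u : State) (F : Finset ℤ) :
    ∑ x ∈ F, ‖u x‖ ^ 5 ≤ ‖u‖ * eightNorm u ^ 4 := by
  have h0 := eightNorm_nonneg u
  refine (sq_le_sq₀ (Finset.sum_nonneg fun _ _ => by positivity) (by positivity)).1 ?_
  calc (∑ x ∈ F, ‖u x‖ ^ 5) ^ 2 = (∑ x ∈ F, ‖u x‖ * ‖u x‖ ^ 4) ^ 2 := by
        congr 1
        exact Finset.sum_congr rfl fun x _ => by ring
    _ ≤ (∑ x ∈ F, ‖u x‖ ^ 2) * ∑ x ∈ F, (‖u x‖ ^ 4) ^ 2 :=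
        Finset.sum_mul_sq_le_sq_mul_sq _ _ _
    _ = (∑ x ∈ F, ‖u x‖ ^ 2) * ∑ x ∈ F, ‖u x‖ ^ 8 := by
        congr 1
        exact Finset.sum_congr rfl fun x _ => by ring
    _ ≤ ‖u‖ ^ 2 * eightNorm u ^ 8 := by
        gcongr
        · exact sum_le_hasSum F (fun x _ => by positivity) (hasSum_norm_sq u)
        · exact sum_le_hasSum F (fun x _ => by positivity) (hasSum_eightNorm u)
    _ = _ := by ring

theorem exists_hasSum_norm_of_quintic {g u : State} {c₀ : ℝ} (hc₀ : 0 ≤ c₀)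
    (h : ∀ x, ‖g x‖ ≤ c₀ * ‖u x‖ ^ 4 * ‖u x‖) :
    ∃ A, HasSum (fun x => ‖g x‖) A ∧ A ≤ c₀ * (‖u‖ * eightNorm u ^ 4) := by
  have hfin : ∀ F : Finset ℤ, ∑ x ∈ F, ‖g x‖ ≤ c₀ * (‖u‖ * eightNorm u ^ 4) := fun F =>
    calc ∑ x ∈ F, ‖g x‖ ≤ ∑ x ∈ F, c₀ * ‖u x‖ ^ 5 :=
          Finset.sum_le_sum fun x _ => (h x).trans_eq (by ring)
      _ ≤ _ := by
          rw [← Finset.mul_sum]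
          gcongr
          exact sum_norm_pow_five_le u F
  have hs := summable_of_sum_le (fun x => norm_nonneg (g x)) hfin
  exact ⟨_, hs.hasSum, hs.tsum_le_of_sum_le hfin⟩

/-- Of the ten powers in the squared `l²` norm, eight sum to the `l⁸` norm and two are bounded
pointwise by it. -/
theorem norm_le_of_quintic {g u : State} {c₀ : ℝ} (hc₀ : 0 ≤ c₀)
    (h : ∀ x, ‖g x‖ ≤ c₀ * ‖u x‖ ^ 4 * ‖u x‖) : ‖g‖ ≤ c₀ * eightNorm u ^ 5 := by
  have h0 := eightNorm_nonneg u
  refine (sq_le_sq₀ (norm_nonneg _) (by positivity)).1 ?_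
  have hx : ∀ x, ‖g x‖ ^ 2 ≤ c₀ ^ 2 * eightNorm u ^ 2 * ‖u x‖ ^ 8 := fun x =>
    calc ‖g x‖ ^ 2 ≤ (c₀ * ‖u x‖ ^ 4 * ‖u x‖) ^ 2 := pow_le_pow_left₀ (norm_nonneg _) (h x) 2
      _ = c₀ ^ 2 * ‖u x‖ ^ 2 * ‖u x‖ ^ 8 := by ring
      _ ≤ _ := by
        gcongr
        exact norm_apply_le_eightNorm u x
  refine (hasSum_le hx (hasSum_norm_sq g) ((hasSum_eightNorm u).mul_left _)).trans_eq ?_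
  ring

theorem summable_succ_rpow_neg {p : ℝ} (hp : 1 < p) :
    Summable fun n : ℕ => ((n + 1 : ℕ) : ℝ) ^ (-p) := by
  have h := (Real.summable_nat_rpow (p := -p)).2 (by linarith)
  exact (summable_nat_add_iff 1).2 h

/-- The larger of `p` and `q` is at least `r / 2`, so its power `-1/4` can be traded for that of
`r`. What remains is a power `-17/16`, summable along the convolution. -/
theorem convolution_term_le {p q r : ℝ} (hp : 0 < p) (hq : 0 < q) (hr : 0 < r)
    (hle : r ≤ p + q) :
    p ^ (-(1 / 4) : ℝ) * q ^ (-(17 / 16) : ℝ) ≤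
      2 * (p ^ (-(17 / 16) : ℝ) + q ^ (-(17 / 16) : ℝ)) * r ^ (-(1 / 4) : ℝ) := by
  have hP : 0 < p ^ (-(17 / 16) : ℝ) := by positivity
  have hQ : 0 < q ^ (-(17 / 16) : ℝ) := by positivity
  have hR : 0 < r ^ (-(1 / 4) : ℝ) := by positivity
  have key : ∀ z : ℝ, 0 < z → r ≤ 2 * z → z ^ (-(1 / 4) : ℝ) ≤ 2 * r ^ (-(1 / 4) : ℝ) := by
    intro z hz hrz
    have e1 : (2 * z) ^ (-(1 / 4) : ℝ) ≤ r ^ (-(1 / 4) : ℝ) :=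
      Real.rpow_le_rpow_of_nonpos hr hrz (by norm_num)
    rw [Real.mul_rpow (by norm_num) hz.le] at e1
    have e2 : (1 / 2 : ℝ) ≤ 2 ^ (-(1 / 4) : ℝ) := by
      rw [one_div, ← Real.rpow_neg_one]
      exact Real.rpow_le_rpow_of_exponent_le (by norm_num) (by norm_num)
    nlinarith [Real.rpow_nonneg hz.le (-(1 / 4) : ℝ)]
  rcases le_total p q with h | h
  · have h1 := key q hq (by linarith)
    have hq2 : q ^ (-(17 / 16) : ℝ) = q ^ (-(1 / 4) : ℝ) * q ^ (-(13 / 16) : ℝ) := by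
      rw [← Real.rpow_add hq]; norm_num
    have hp2 : p ^ (-(17 / 16) : ℝ) = p ^ (-(1 / 4) : ℝ) * p ^ (-(13 / 16) : ℝ) := by
      rw [← Real.rpow_add hp]; norm_num
    have h2 : q ^ (-(13 / 16) : ℝ) ≤ p ^ (-(13 / 16) : ℝ) :=
      Real.rpow_le_rpow_of_nonpos hp h (by norm_num)
    calc p ^ (-(1 / 4) : ℝ) * q ^ (-(17 / 16) : ℝ)
        = p ^ (-(1 / 4) : ℝ) * (q ^ (-(1 / 4) : ℝ) * q ^ (-(13 / 16) : ℝ)) := by rw [hq2]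
      _ ≤ p ^ (-(1 / 4) : ℝ) * ((2 * r ^ (-(1 / 4) : ℝ)) * p ^ (-(13 / 16) : ℝ)) := by gcongr
      _ = 2 * p ^ (-(17 / 16) : ℝ) * r ^ (-(1 / 4) : ℝ) := by rw [hp2]; ring
      _ ≤ _ := by gcongr; linarith
  · have h1 := key p hp (by linarith)
    calc p ^ (-(1 / 4) : ℝ) * q ^ (-(17 / 16) : ℝ)
        ≤ (2 * r ^ (-(1 / 4) : ℝ)) * q ^ (-(17 / 16) : ℝ) := by gcongr
      _ = 2 * q ^ (-(17 / 16) : ℝ) * r ^ (-(1 / 4) : ℝ) := by ring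
      _ ≤ _ := by gcongr; linarith

theorem exists_convolution_le : ∃ Z : ℝ, 0 < Z ∧ ∀ t : ℕ,
    ∑ s ∈ Finset.range t,
      ((t - s + 1 : ℕ) : ℝ) ^ (-(1 / 4) : ℝ) * ((s + 1 : ℕ) : ℝ) ^ (-(17 / 16) : ℝ) ≤
      Z * ((t + 1 : ℕ) : ℝ) ^ (-(1 / 4) : ℝ) := by
  set w : ℕ → ℝ := fun n => ((n + 1 : ℕ) : ℝ) ^ (-(17 / 16) : ℝ) with hw
  have hw0 : ∀ n, 0 < w n := fun n => by simp only [hw]; positivity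
  have hs : Summable w := summable_succ_rpow_neg (by norm_num)
  have hle : ∀ t, ∑ s ∈ Finset.range t, w s ≤ ∑' n, w n :=
    fun t => hs.sum_le_tsum _ fun n _ => (hw0 n).le
  have hle' : ∀ t, ∑ s ∈ Finset.range t, w (t - s) ≤ ∑' n, w n := fun t => by
    have h1 := Finset.sum_range_reflect (fun s => w (s + 1)) t
    have h2 : ∑ s ∈ Finset.range t, w (t - s) = ∑ s ∈ Finset.range t, w (t - 1 - s + 1) := by
      refine Finset.sum_congr rfl fun s hs => ?_
      rw [Finset.mem_range] at hs
      congr 1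
      omega
    have h3 := Finset.sum_range_succ' w t
    rw [h2, h1]
    linarith [hle (t + 1), hw0 0]
  refine ⟨4 * ∑' n, w n, by have := hs.tsum_pos (fun n => (hw0 n).le) 0 (hw0 0); positivity,
    fun t => ?_⟩
  calc _ ≤ ∑ s ∈ Finset.range t,
        2 * (w (t - s) + w s) * ((t + 1 : ℕ) : ℝ) ^ (-(1 / 4) : ℝ) := by
        refine Finset.sum_le_sum fun s hs => ?_
        rw [Finset.mem_range] at hs
        refine convolution_term_le (by positivity) (by positivity) (by positivity) ?_
        exact_mod_cast (by omega : t + 1 ≤ t - s + 1 + (s + 1))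
    _ = 2 * (∑ s ∈ Finset.range t, w (t - s) + ∑ s ∈ Finset.range t, w s) *
        ((t + 1 : ℕ) : ℝ) ^ (-(1 / 4) : ℝ) := by
      rw [← Finset.sum_mul, ← Finset.mul_sum, Finset.sum_add_distrib]
    _ ≤ 2 * (∑' n, w n + ∑' n, w n) * ((t + 1 : ℕ) : ℝ) ^ (-(1 / 4) : ℝ) := by
      gcongr
      · exact hle' t
      · exact hle t
    _ = _ := by ring

theorem hasSum_norm_toState (u : StateOne) : HasSum (fun x => ‖u.toState x‖) ‖u‖ := by
  have h := lp.hasSum_norm (p := 1) (by norm_num) u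
  simp only [ENNReal.toReal_one, Real.rpow_one] at h
  exact h

theorem norm_toState_le (u : StateOne) : ‖u.toState‖ ≤ ‖u‖ := by
  refine (sq_le_sq₀ (norm_nonneg _) (norm_nonneg _)).1 ?_
  have hx : ∀ x, ‖u.toState x‖ ^ 2 ≤ ‖u‖ * ‖u.toState x‖ := fun x => by
    rw [sq]
    gcongr
    exact lp.norm_apply_le_norm (p := 1) (by norm_num) u x
  exact (hasSum_le hx (hasSum_norm_sq _) ((hasSum_norm_toState u).mul_left _)).trans_eq (sq _).symm

theorem exists_scatters_of_quintic {C₀ : U2} {CN : ℝ → ℝ → U2} {D c₀ : ℝ} (hD : 0 < D)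
    (hW : IsDispersive (linearWalk C₀) D) (hc₀ : 0 < c₀)
    (hCN : ∀ s₁ s₂ : ℝ, 0 ≤ s₁ → 0 ≤ s₂ →
      ‖op ((CN s₁ s₂ : Matrix (Fin 2) (Fin 2) ℂ) - 1)‖ ≤ c₀ * (s₁ + s₂) ^ 2) :
    ∃ δ : ℝ, 0 < δ ∧ ∀ u₀ : StateOne, ‖u₀‖ < δ → Scatters C₀ CN u₀.toState := by
  obtain ⟨Z, hZ, hconv⟩ := exists_convolution_le
  set E := D ^ (3 / 4 : ℝ) with hE
  have hE0 : 0 < E := by positivity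
  -- The relative size of the Duhamel term is `L * d ^ 4`; making it less than `1` closes the
  -- induction with twice the free bound.
  set L := c₀ * (2 * E) ^ (17 / 4 : ℝ) * Z with hL
  have hlim : Tendsto (fun d : ℝ => L * d ^ 4) (𝓝 0) (𝓝 0) := by
    have : Continuous fun d : ℝ => L * d ^ 4 := by fun_prop
    simpa using this.tendsto 0
  obtain ⟨δ, hδ, hsmall⟩ := Metric.eventually_nhds_iff.1 (hlim.eventually (gt_mem_nhds one_pos))
  refine ⟨δ, hδ, fun u₀ hu₀ => ?_⟩
  have hd := hsmall (y := ‖u₀‖) (by simpa using hu₀)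
  set d := ‖u₀‖ with hd'
  have hd0 : 0 ≤ d := norm_nonneg _
  set u : ℕ → State := fun t => evolution (nonlinearCoin C₀ CN) t u₀.toState with hu
  have hu2 : ∀ t, ‖u t‖ ≤ d := fun t => (norm_evolution _ t _).trans_le (norm_toState_le u₀)
  have hG := fun t => norm_nonlinearity_apply_le hCN (u t)
  have hfree : ∀ t, eightNorm ((linearWalk C₀ ^ t) u₀.toState) ≤
      E * ((t + 1 : ℕ) : ℝ) ^ (-(1 / 4) : ℝ) * d :=
    hW.eightNorm_le hD (hasSum_norm_toState u₀) (norm_toState_le u₀) hd0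
      (by rw [← pow_add])
  have hforced : ∀ s, eightNorm (u s) ≤ 2 * E * d * ((s + 1 : ℕ) : ℝ) ^ (-(1 / 4) : ℝ) →
      ∀ n, eightNorm ((linearWalk C₀ ^ n) (nonlinearity CN (u s))) ≤
        E * ((n + 1 : ℕ) : ℝ) ^ (-(1 / 4) : ℝ) *
          (c₀ * (2 * E) ^ (17 / 4 : ℝ) * d ^ 5 * ((s + 1 : ℕ) : ℝ) ^ (-(17 / 16) : ℝ)) := by
    intro s hs n
    obtain ⟨A, hA, hAle⟩ := exists_hasSum_norm_of_quintic hc₀.le (hG s)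
    have hN0 := eightNorm_nonneg (u s)
    have hA0 : 0 ≤ A := hA.nonneg fun x => norm_nonneg _
    refine hW.eightNorm_le hD hA (norm_le_of_quintic hc₀.le (hG s)) (by positivity) ?_ n
    have hs0 : (0 : ℝ) < (s + 1 : ℕ) := by positivity
    calc A ^ 6 * (c₀ * eightNorm (u s) ^ 5) ^ 2
        ≤ (c₀ * (d * eightNorm (u s) ^ 4)) ^ 6 * (c₀ * eightNorm (u s) ^ 5) ^ 2 := by
          gcongr
          refine hAle.trans ?_
          gcongr
          exact hu2 s
      -- The exponent is `34 = 4·6 + 5·2`; its eighth root `17/4` times the rate `1/4` gives `17/16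
      -- > 1`.
      _ = c₀ ^ 8 * d ^ 6 * eightNorm (u s) ^ 34 := by ring
      _ ≤ c₀ ^ 8 * d ^ 6 * (2 * E * d * ((s + 1 : ℕ) : ℝ) ^ (-(1 / 4) : ℝ)) ^ 34 := by gcongr
      _ = c₀ ^ 8 * ((2 * E) ^ 34) * (d ^ 5) ^ 8 *
          (((s + 1 : ℕ) : ℝ) ^ (-(1 / 4) : ℝ)) ^ 34 := by ring
      _ = c₀ ^ 8 * ((2 * E) ^ (17 / 4 : ℝ)) ^ 8 * (d ^ 5) ^ 8 *
          (((s + 1 : ℕ) : ℝ) ^ (-(17 / 16) : ℝ)) ^ 8 := by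
          congr 1
          · congr 2
            rw [← Real.rpow_natCast ((2 * E) ^ (17 / 4 : ℝ)), ← Real.rpow_mul (by positivity),
              ← Real.rpow_natCast]
            norm_num
          · rw [← Real.rpow_natCast, ← Real.rpow_natCast, ← Real.rpow_mul hs0.le,
              ← Real.rpow_mul hs0.le]
            norm_num
      _ = _ := by ring
  have hdecay : ∀ t, eightNorm (u t) ≤ 2 * E * d * ((t + 1 : ℕ) : ℝ) ^ (-(1 / 4) : ℝ) := by
    intro t
    induction t using Nat.strong_induction_on with
    | _ t ih =>
      have hdec : u t = (linearWalk C₀ ^ t) u₀.toState + ∑ s ∈ Finset.range t,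
          (linearWalk C₀ ^ (t - s)) (nonlinearity CN (u s)) := by
        simp only [hu]
        rw [evolution_eq, map_add, map_sum]
        congr 1
        exact Finset.sum_congr rfl fun s hs => pow_inv_apply _ (Finset.mem_range.1 hs).le _
      rw [hdec]
      refine (eightNorm_add_le _ _).trans ?_
      have hsum : eightNorm (∑ s ∈ Finset.range t,
          (linearWalk C₀ ^ (t - s)) (nonlinearity CN (u s))) ≤
          E * d * ((t + 1 : ℕ) : ℝ) ^ (-(1 / 4) : ℝ) := by
        calc _ ≤ _ := eightNorm_sum_le _ _
          _ ≤ ∑ s ∈ Finset.range t, E * ((t - s + 1 : ℕ) : ℝ) ^ (-(1 / 4) : ℝ) *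
              (c₀ * (2 * E) ^ (17 / 4 : ℝ) * d ^ 5 * ((s + 1 : ℕ) : ℝ) ^ (-(17 / 16) : ℝ)) :=
            Finset.sum_le_sum fun s hs =>
              hforced s (ih s (Finset.mem_range.1 hs)) (t - s)
          _ = E * (c₀ * (2 * E) ^ (17 / 4 : ℝ) * d ^ 5) * ∑ s ∈ Finset.range t,
              ((t - s + 1 : ℕ) : ℝ) ^ (-(1 / 4) : ℝ) *
                ((s + 1 : ℕ) : ℝ) ^ (-(17 / 16) : ℝ) := by
            rw [Finset.mul_sum]
            exact Finset.sum_congr rfl fun s _ => by ring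
          _ ≤ E * (c₀ * (2 * E) ^ (17 / 4 : ℝ) * d ^ 5) *
              (Z * ((t + 1 : ℕ) : ℝ) ^ (-(1 / 4) : ℝ)) := by
            gcongr
            exact hconv t
          _ = E * d * ((t + 1 : ℕ) : ℝ) ^ (-(1 / 4) : ℝ) * (L * d ^ 4) := by rw [hL]; ring
          _ ≤ E * d * ((t + 1 : ℕ) : ℝ) ^ (-(1 / 4) : ℝ) * 1 := by gcongr
          _ = _ := mul_one _
      linarith [hfree t]
  refine scatters_of_summable (((summable_succ_rpow_neg (p := 5 / 4) (by norm_num)).mul_left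
    (c₀ * (2 * E * d) ^ 5)).of_nonneg_of_le (fun s => norm_nonneg _) fun s => ?_)
  have hs0 : (0 : ℝ) < (s + 1 : ℕ) := by positivity
  have hN0 := eightNorm_nonneg (u s)
  calc _ ≤ c₀ * eightNorm (u s) ^ 5 := norm_le_of_quintic hc₀.le (hG s)
    _ ≤ c₀ * (2 * E * d * ((s + 1 : ℕ) : ℝ) ^ (-(1 / 4) : ℝ)) ^ 5 := by
      gcongr
      exact hdecay s
    _ = c₀ * (2 * E * d) ^ 5 * (((s + 1 : ℕ) : ℝ) ^ (-(1 / 4) : ℝ)) ^ 5 := by ring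
    _ = _ := by
      congr 1
      rw [← Real.rpow_natCast, ← Real.rpow_mul hs0.le]
      norm_num

end QW
end

theorem theorem1p1 (a b : ℂ) (hab : ‖a‖ ^ 2 + ‖b‖ ^ 2 = 1) (ha₀ : 0 < ‖a‖) (ha₁ : ‖a‖ < 1)
    (CN : ℝ → ℝ → QW.U2) :
    (QW.IsHigherOrder CN 3 →
      ∃ δ : ℝ, 0 < δ ∧ ∀ u₀ : QW.State, ‖u₀‖ < δ →
        QW.Scatters (QW.linearCoin a b hab) CN u₀) ∧
    (QW.IsHigherOrder CN 2 →
      ∃ δ : ℝ, 0 < δ ∧ ∀ u₀ : QW.StateOne, ‖u₀‖ < δ →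
        QW.Scatters (QW.linearCoin a b hab) CN u₀.toState) := by
  obtain ⟨D, hD, hW⟩ := QW.exists_isDispersive hab ha₀ ha₁
  refine ⟨fun h => ?_, fun h => ?_⟩
  · obtain ⟨c₀, hc₀, hbound⟩ := h.bound
    exact QW.exists_scatters_of_septic hD hW hc₀ fun s₁ s₂ h₁ h₂ => (hbound s₁ s₂ h₁ h₂).1
  · obtain ⟨c₀, hc₀, hbound⟩ := h.bound
    exact QW.exists_scatters_of_quintic hD hW hc₀ fun s₁ s₂ h₁ h₂ => (hbound s₁ s₂ h₁ h₂).1
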